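/- Let $n\ge 2$, let $\mathbb T^n=\mathbb R^n/\mathbb Z^n$, and for a torus distribution $g$ put $\hat g(\xi)=\langle g,e^{-2\pi i x\cdot\xi}\rangle$, $\xi\in\mathbb Z^n$. For $s\in\mathbb R$ let $H^s_\#$ be the space of torus distributions $g$ with $\|g\|_{H^s_\#}^2=\sum_{\xi\in\mathbb Z^n}(1+|\xi|^2)^{s}|\hat g(\xi)|^2<\infty$, let $\mathbf H^s_\#=(H^s_\#)^n$ with $\|\mathbf w\|_{\mathbf H^s_\#}^2=\sum_k\|w_k\|^2_{H^s_\#}$, let $\dot{\mathbf H}^s_\#$ be the subspace of the $\mathbf w\in\mathbf H^s_\#$ with $\langle w_k,1\rangle=0$ for all $k$, and $\dot{\mathbf H}^s_{\#\sigma}=\{\mathbf w\in\dot{\mathbf H}^s_\#:\operatorname{div}\mathbf w=0\}$. Let $B\mathbf w=(\mathbf w\cdot\nabla)\mathbf w$, understood as the limit in the sense of distributions of $(\mathbf w_m\cdot\nabla)\mathbf w_m$, where $\mathbf w_m=\sum_{|\xi|\le m}\hat{\mathbf w}(\xi)e^{2\pi i x\cdot\xi}$. (i) If $0<s<n/2$,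 then $B:\dot{\mathbf H}^s_{\#\sigma}\to\dot{\mathbf H}^{2s-1-n/2}_\#$ is a well defined, continuous and bounded quadratic operator: there is a constant $C_{n,s}>0$ such that $$\|B\mathbf w\|_{\mathbf H^{2s-1-n/2}_\#}\le C_{n,s}\|\mathbf w\|^2_{\mathbf H^s_\#}$$ for all $\mathbf w\in\dot{\mathbf H}^s_{\#\sigma}$. With the same constant, $B\mathbf w$ exists in $\mathbf H^{2s-1-n/2}_\#$ and the estimate holds for all divergence-free $\mathbf w\in\mathbf H^s_\#$ and, if $s>1/2$, for all $\mathbf w\in\mathbf H^s_\#$. (ii) If $s>n/2$, then $B:\dot{\mathbf H}^s_{\#\sigma}\to\dot{\mathbf H}^{s-1}_\#$ is a well defined, continuous and bounded quadratic operator: there is a constant $C_{n,s}>0$ such that $$\|B\mathbf w\|_{\mathbf H^{s-1}_\#}\le C_{n,s}\|\mathbf w\|^2_{\mathbf H^s_\#}$$ for all $\mathbf w\in\dot{\mathbf H}^s_{\#\sigma}$; more generally, $B\mathbf w$ exists in $\mathbf H^{s-1}_\#$ and this estimate holds, with the same constant, for all $\mathbf w\in\mathbf H^s_\#$. -/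

import Mathlib

open scoped ContDiff

noncomputable section

namespace TorusNS

/-- Integer vectors, the frequencies. -/
abbrev Freq (n : ℕ) : Type := Fin n → ℤ

/-- The lattice vector `ξ` as a point of `ℝⁿ`. -/
def latticePt {n : ℕ} (ξ : Freq n) : EuclideanSpace ℝ (Fin n) :=
  WithLp.toLp 2 (fun i => (ξ i : ℝ))

/-- Smooth complex-valued `1`-periodic functions on `ℝⁿ`, that is, smooth functions on the torus. -/
def PeriodicSmooth (n : ℕ) : Submodule ℂ (EuclideanSpace ℝ (Fin n) → ℂ) where
  carrier := {φ | ContDiff ℝ ∞ φ ∧ ∀ (ξ : Freq n) (x), φ (x + latticePt ξ) = φ x}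
  add_mem' := by
    rintro φ ψ ⟨h1, h2⟩ ⟨h3, h4⟩
    exact ⟨h1.add h3, fun ξ x => by simp [h2, h4]⟩
  zero_mem' := ⟨contDiff_const, fun _ _ => rfl⟩
  smul_mem' := by
    rintro c φ ⟨h1, h2⟩
    exact ⟨h1.const_smul c, fun ξ x => by simp [h2]⟩

/-- The partial derivative `∂ⱼ` on smooth periodic functions. -/
def pderiv {n : ℕ} (j : Fin n) : PeriodicSmooth n →ₗ[ℂ] PeriodicSmooth n where
  toFun φ := ⟨fun x => fderiv ℝ (φ : EuclideanSpace ℝ (Fin n) → ℂ) x (EuclideanSpace.single j 1), by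
    refine ⟨(φ.2.1.fderiv_right (m := ∞) (by simp)).clm_apply contDiff_const, fun ξ x => ?_⟩
    have h : (fun y => (φ : EuclideanSpace ℝ (Fin n) → ℂ) (y + latticePt ξ)) = φ :=
      funext (φ.2.2 ξ)
    change fderiv ℝ (φ : EuclideanSpace ℝ (Fin n) → ℂ) (x + latticePt ξ) _ = _
    rw [← fderiv_comp_add_right, h]⟩
  map_add' φ ψ := by
    ext x
    have h1 := (φ.2.1.differentiable (by simp)) x
    have h2 := (ψ.2.1.differentiable (by simp)) x
    simp [fderiv_add h1 h2]
  map_smul' c φ := by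
    ext x
    have h1 := (φ.2.1.differentiable (by simp)) x
    simp [fderiv_const_smul h1 c]

/-- The character `x ↦ exp (2 π i x·ξ)`. -/
def char {n : ℕ} (ξ : Freq n) : PeriodicSmooth n :=
  ⟨fun x => Complex.exp (2 * Real.pi * Complex.I * ((∑ j, x j * (ξ j : ℝ) : ℝ) : ℂ)), by
    constructor
    · have h : ContDiff ℝ ∞ fun x : EuclideanSpace ℝ (Fin n) => ∑ j, x j * (ξ j : ℝ) :=
        ContDiff.sum fun j _ =>
          (EuclideanSpace.proj j : EuclideanSpace ℝ (Fin n) →L[ℝ] ℝ).contDiff.mul contDiff_const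
      exact Complex.contDiff_exp.comp
        (contDiff_const.mul (Complex.ofRealCLM.contDiff.comp h))
    · intro η x
      refine Complex.exp_eq_exp_iff_exists_int.2 ⟨∑ j, η j * ξ j, ?_⟩
      simp only [latticePt, PiLp.add_apply, add_mul, Finset.sum_add_distrib]
      push_cast
      ring⟩

/-- Torus distributions: the linear functionals on the smooth periodic functions that are
continuous, i.e. bounded by finitely many of the seminorms `sup |Dᵏ φ|`. -/
def Dist (n : ℕ) : Submodule ℂ (PeriodicSmooth n →ₗ[ℂ] ℂ) where
  carrier := {g | ∃ (C : ℝ) (N : ℕ), ∀ (φ : PeriodicSmooth n) (M : ℝ),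
    (∀ k ≤ N, ∀ x, ‖iteratedFDeriv ℝ k (φ : EuclideanSpace ℝ (Fin n) → ℂ) x‖ ≤ M) →
      ‖g φ‖ ≤ C * M}
  add_mem' := by
    rintro g h ⟨C, N, hg⟩ ⟨C', N', hh⟩
    refine ⟨C + C', max N N', fun φ M hM => ?_⟩
    have h1 := hg φ M (fun k hk => hM k (hk.trans (le_max_left _ _)))
    have h2 := hh φ M (fun k hk => hM k (hk.trans (le_max_right _ _)))
    calc ‖(g + h) φ‖ ≤ ‖g φ‖ + ‖h φ‖ := norm_add_le _ _
      _ ≤ (C + C') * M := by linarith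
  zero_mem' := ⟨0, 0, fun φ M _ => by simp⟩
  smul_mem' := by
    rintro c g ⟨C, N, hg⟩
    refine ⟨‖c‖ * C, N, fun φ M hM => ?_⟩
    have h1 := mul_le_mul_of_nonneg_left (hg φ M hM) (norm_nonneg c)
    simpa [mul_assoc] using h1

/-- The distributional derivative, `⟨∂ⱼ g, φ⟩ = -⟨g, ∂ⱼ φ⟩`. -/
def distDeriv {n : ℕ} (j : Fin n) (g : Dist n) : Dist n :=
  ⟨-((g : PeriodicSmooth n →ₗ[ℂ] ℂ) ∘ₗ pderiv j), by
    obtain ⟨C, N, hg⟩ := g.2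
    refine ⟨C, N + 1, fun φ M hM => ?_⟩
    have h := hg (pderiv j φ) M (fun k hk x => ?_)
    · simpa using h
    · have h1 : ContDiff ℝ k (fderiv ℝ (φ : EuclideanSpace ℝ (Fin n) → ℂ)) :=
        φ.2.1.fderiv_right (by exact_mod_cast le_top)
      have h2 := norm_iteratedFDeriv_clm_apply_const (𝕜 := ℝ)
        (c := (EuclideanSpace.single j 1 : EuclideanSpace ℝ (Fin n))) (n := k)
        (h1.contDiffAt (x := x)) le_rfl
      rw [norm_iteratedFDeriv_fderiv, PiLp.norm_single, norm_one, one_mul] at h2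
      exact h2.trans (hM (k + 1) (by omega) x)⟩

/-- The Fourier coefficient `ĝ(ξ) = ⟨g, exp (-2 π i x·ξ)⟩`. -/
def fourierCoef {n : ℕ} (g : Dist n) (ξ : Freq n) : ℂ := g.1 (char (-ξ))

/-- `ρ(ξ) = (1 + |ξ|²)^{1/2}`. -/
def rho {n : ℕ} (ξ : Freq n) : ℝ := Real.sqrt (1 + ∑ j, (ξ j : ℝ) ^ 2)

/-- The Sobolev space `H^s_#`. -/
def Sobolev (n : ℕ) (s : ℝ) : Submodule ℂ (Dist n) where
  carrier := {g | Summable fun ξ : Freq n => rho ξ ^ (2 * s) * ‖fourierCoef g ξ‖ ^ 2}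
  add_mem' := by
    intro g h hg hh
    refine Summable.of_nonneg_of_le
      (fun ξ => mul_nonneg (Real.rpow_nonneg (Real.sqrt_nonneg _) _) (sq_nonneg _)) (fun ξ => ?_)
      ((hg.add hh).mul_left 2)
    have h0 : 0 ≤ rho ξ ^ (2 * s) := Real.rpow_nonneg (Real.sqrt_nonneg _) _
    have h1 : ‖fourierCoef (g + h) ξ‖ ≤ ‖fourierCoef g ξ‖ + ‖fourierCoef h ξ‖ := norm_add_le _ _
    have h2 : ‖fourierCoef (g + h) ξ‖ ^ 2 ≤
        2 * (‖fourierCoef g ξ‖ ^ 2 + ‖fourierCoef h ξ‖ ^ 2) := by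
      nlinarith [norm_nonneg (fourierCoef (g + h) ξ),
        sq_nonneg (‖fourierCoef g ξ‖ - ‖fourierCoef h ξ‖)]
    nlinarith [mul_le_mul_of_nonneg_left h2 h0]
  zero_mem' := by
    have h : ∀ ξ : Freq n, fourierCoef (0 : Dist n) ξ = 0 := fun _ => rfl
    simp [h]
  smul_mem' := by
    intro c g hg
    have h : ∀ ξ : Freq n, fourierCoef (c • g) ξ = c * fourierCoef g ξ := fun _ => rfl
    refine (hg.mul_left (‖c‖ ^ 2)).congr fun ξ => ?_
    rw [h, norm_mul]
    ring

/-- The space `(H^s_#)ⁿ` of vector fields with components in `H^s_#`. -/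
def SobolevVec (n : ℕ) (s : ℝ) : Submodule ℂ (Fin n → Dist n) :=
  Submodule.pi Set.univ fun _ => Sobolev n s

/-- The norm of `(H^s_#)ⁿ`. -/
def sobolevNorm {n : ℕ} (s : ℝ) (w : Fin n → Dist n) : ℝ :=
  Real.sqrt (∑ k, ∑' ξ : Freq n, rho ξ ^ (2 * s) * ‖fourierCoef (w k) ξ‖ ^ 2)

/-- The distributional divergence. -/
def div {n : ℕ} (w : Fin n → Dist n) : Dist n := ∑ j, distDeriv j (w j)

/-- The space of `w ∈ (H^s_#)ⁿ` with zero mean, `⟨w, 1⟩ = 0`. -/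
def SobolevDot (n : ℕ) (s : ℝ) : Submodule ℂ (Fin n → Dist n) where
  carrier := {w | w ∈ SobolevVec n s ∧ ∀ k, (w k).1 (char 0) = 0}
  add_mem' := by
    rintro v w ⟨h1, h2⟩ ⟨h3, h4⟩
    exact ⟨add_mem h1 h3, fun k => by simp [h2, h4]⟩
  zero_mem' := ⟨zero_mem _, fun _ => rfl⟩
  smul_mem' := by
    rintro c w ⟨h1, h2⟩
    exact ⟨Submodule.smul_mem _ c h1, fun k => by simp [h2]⟩

/-- The space of divergence-free `w ∈ (H^s_#)ⁿ` with zero mean. -/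
def SobolevDotSigma (n : ℕ) (s : ℝ) : Submodule ℂ (Fin n → Dist n) where
  carrier := {w | w ∈ SobolevDot n s ∧ div w = 0}
  add_mem' := by
    rintro v w ⟨h1, h2⟩ ⟨h3, h4⟩
    refine ⟨add_mem h1 h3, ?_⟩
    have h : div (v + w) = div v + div w := by
      unfold div
      rw [← Finset.sum_add_distrib]
      refine Finset.sum_congr rfl fun j _ => Subtype.ext (LinearMap.ext fun φ => ?_)
      simp [distDeriv, add_comm]
    rw [h, h2, h4, add_zero]
  zero_mem' := by
    refine ⟨zero_mem _, Finset.sum_eq_zero fun j _ => Subtype.ext (LinearMap.ext fun φ => ?_)⟩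
    simp [distDeriv]
  smul_mem' := by
    rintro c w ⟨h1, h2⟩
    refine ⟨Submodule.smul_mem _ c h1, ?_⟩
    have h : div (c • w) = c • div w := by
      unfold div
      rw [Finset.smul_sum]
      refine Finset.sum_congr rfl fun j _ => Subtype.ext (LinearMap.ext fun φ => ?_)
      simp [distDeriv]
    rw [h, h2, smul_zero]

/-- The frequencies with `|ξ| ≤ m`. -/
def freqBall (n m : ℕ) : Finset (Freq n) :=
  (Fintype.piFinset fun _ => Finset.Icc (-(m : ℤ)) m).filter fun ξ => ∑ j, ξ j ^ 2 ≤ (m : ℤ) ^ 2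

/-- The Fourier partial sum `g_m`, the sum of `ĝ(ξ) exp (2 π i x·ξ)` over `|ξ| ≤ m`. -/
def partialSum {n : ℕ} (m : ℕ) (g : Dist n) : PeriodicSmooth n :=
  ∑ ξ ∈ freqBall n m, fourierCoef g ξ • char ξ

/-- The `k`-th component of `(v·∇)v` for a smooth periodic vector field `v`. -/
def smoothAdvection {n : ℕ} (v : Fin n → PeriodicSmooth n) (k : Fin n)
    (x : EuclideanSpace ℝ (Fin n)) : ℂ :=
  ∑ j, (v j).1 x * (pderiv j (v k)).1 x

/-- The torus parametrised as the cube `[0,1)ⁿ`. -/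
def cube (n : ℕ) : Set (EuclideanSpace ℝ (Fin n)) := {x | ∀ i, x i ∈ Set.Ico (0 : ℝ) 1}

/-- The distribution `b` is the product `(w·∇)w`: it is the limit, in the sense of distributions,
of the smooth fields `(w_m·∇)w_m` formed from the Fourier partial sums `w_m` of `w`. -/
def IsAdvection {n : ℕ} (w b : Fin n → Dist n) : Prop :=
  ∀ (k : Fin n) (φ : PeriodicSmooth n),
    Filter.Tendsto
      (fun m : ℕ => ∫ x in cube n, smoothAdvection (fun j => partialSum m (w j)) k x * φ.1 x)
      Filter.atTop (nhds ((b k).1 φ))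

/-- Continuity of a map between spaces of vector fields, from the `H^s` norm to the `H^t` norm. -/
def SobolevContinuous {n : ℕ} (s t : ℝ) {X Y : Submodule ℂ (Fin n → Dist n)} (F : X → Y) : Prop :=
  ∀ w : X, ∀ ε > 0, ∃ δ > 0, ∀ w' : X,
    sobolevNorm s (w'.1 - w.1) < δ → sobolevNorm t ((F w').1 - (F w).1) < ε

end TorusNS

end

open scoped ContDiff

noncomputable section

namespace TorusNS

open scoped ENNReal
open MeasureTheory

/-! In Fourier coefficients a product is a convolution over `ℤⁿ` and `∂ⱼ` is multiplication by
`2πiξⱼ`, so the theorem rests on weighted `ℓ²` bounds for convolutions, with weights that are powers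
of `ρ(ξ)`.

Two product laws carry the estimates. If `s₁, s₂ < n/2` and `s₁ + s₂ > 0`, then `H^{s₁} · H^{s₂} ⊆
H^{s₁+s₂-n/2}` (`productBound_subcritical`): pairs `(ξ, η)` are split according to whether one
frequency dominates or both are comparable, and in each region Cauchy–Schwarz reduces the claim to
the growth of `∑ ρ^α` over balls. If `s₁ > n/2` and `0 ≤ s₂ ≤ s₁`, then `H^{s₁} · H^{s₂} ⊆ H^{s₂}`
(`productBound_supercritical`), because `ρ^{-s₁}` is square summable.

For divergence-free `w` one has `(w·∇)w = div (w ⊗ w)`: multiply in `H^s × H^s`, then lose one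
derivative. In the subcritical range this needs only `2s > 0`. For general `w` one multiplies `w ∈
H^s` by `∇w ∈ H^{s-1}`, which needs `2s - 1 > 0`, hence the condition `s > 1/2`. Both routes lead to
the same target space.

The limit exists because, paired with a smooth `φ`, the double series over `(ξ, η)` converges
absolutely (`ProductBound.hasSum_pairing`), and the integrals built from the truncations `w_m` are
its partial sums over products of balls. Zero mean comes from the factor `ζⱼ` at `ζ = 0`, and
continuity from the boundedness of the bilinear map `(u, v) ↦ div (u ⊗ v)`. -/

variable {n : ℕ}

/-! ### The weight `ρ` and lattice sums of its powers -/

theorem one_le_rho (ξ : Freq n) : 1 ≤ rho ξ := by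
  rw [rho, Real.one_le_sqrt]
  have : 0 ≤ ∑ j, (ξ j : ℝ) ^ 2 := Finset.sum_nonneg fun j _ => sq_nonneg _
  linarith

theorem rho_pos (ξ : Freq n) : 0 < rho ξ := one_pos.trans_le (one_le_rho ξ)

theorem rho_sq (ξ : Freq n) : rho ξ ^ 2 = 1 + ∑ j, (ξ j : ℝ) ^ 2 :=
  Real.sq_sqrt (add_nonneg zero_le_one (Finset.sum_nonneg fun _ _ => sq_nonneg _))

@[simp] theorem rho_neg (ξ : Freq n) : rho (-ξ) = rho ξ := by simp [rho]

theorem rho_add_le (ξ η : Freq n) : rho (ξ + η) ≤ rho ξ + rho η := by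
  refine abs_le_of_sq_le_sq' ?_ (add_nonneg (rho_pos ξ).le (rho_pos η).le) |>.2
  have h1 : ∑ j, (ξ j : ℝ) * η j ≤ rho ξ * rho η := by
    refine (Real.sum_mul_le_sqrt_mul_sqrt _ _ _).trans ?_
    unfold rho
    gcongr <;> linarith
  have h2 : ∑ j, (((ξ + η) j : ℤ) : ℝ) ^ 2 =
      ∑ j, (ξ j : ℝ) ^ 2 + 2 * ∑ j, (ξ j : ℝ) * η j + ∑ j, (η j : ℝ) ^ 2 := by
    rw [Finset.mul_sum, ← Finset.sum_add_distrib, ← Finset.sum_add_distrib]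
    refine Finset.sum_congr rfl fun j _ => ?_
    simp only [Pi.add_apply]
    push_cast
    ring
  have h3 := rho_sq ξ
  have h4 := rho_sq η
  rw [rho_sq, h2]
  nlinarith

theorem abs_coord_le_rho (ξ : Freq n) (j : Fin n) : |(ξ j : ℝ)| ≤ rho ξ := by
  rw [← Real.sqrt_sq_eq_abs]
  refine Real.sqrt_le_sqrt ?_
  have := Finset.single_le_sum (f := fun j => (ξ j : ℝ) ^ 2) (fun i _ => sq_nonneg _)
    (Finset.mem_univ j)
  linarith

/-- The box of frequencies with coordinates of modulus at most `m`. -/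
def freqBox (n m : ℕ) : Finset (Freq n) := Fintype.piFinset fun _ => Finset.Icc (-(m : ℤ)) m

theorem mem_freqBox {R : ℝ} {ξ : Freq n} (h : rho ξ ≤ R) : ξ ∈ freqBox n ⌊R⌋₊ := by
  refine Fintype.mem_piFinset.2 fun j => ?_
  have h1 : ((ξ j).natAbs : ℝ) ≤ R := by
    rw [Nat.cast_natAbs]
    push_cast
    exact (abs_coord_le_rho ξ j).trans h
  have h2 := Nat.le_floor h1
  rw [Finset.mem_Icc]
  omega

theorem card_freqBox (n m : ℕ) : (freqBox n m).card = (2 * m + 1) ^ n := by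
  rw [freqBox, Fintype.card_piFinset]
  simp only [Int.card_Icc, Finset.prod_const, Finset.card_univ, Fintype.card_fin]
  congr 1
  omega

theorem ratio_rpow_le {r M : ℝ} (s : ℝ) (hM : 1 ≤ M) (h1 : M⁻¹ ≤ r) (h2 : r ≤ M) :
    r ^ s ≤ M ^ |s| := by
  have hM0 : 0 < M := by linarith
  have hr : 0 < r := lt_of_lt_of_le (inv_pos.2 hM0) h1
  rcases le_total 0 s with hs | hs
  · rw [abs_of_nonneg hs]
    exact Real.rpow_le_rpow hr.le h2 hs
  · rw [abs_of_nonpos hs, Real.rpow_neg hM0.le, ← Real.inv_rpow hM0.le]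
    exact Real.rpow_le_rpow_of_nonpos (inv_pos.2 hM0) h1 hs

/-- `∑ ρ(ξ)^α` over the frequencies with `ρ(ξ) ≤ R`. -/
def ballSum (n : ℕ) (α R : ℝ) : ℝ≥0∞ :=
  ∑' ξ : Freq n, if rho ξ ≤ R then ENNReal.ofReal (rho ξ ^ α) else 0

theorem ballSum_eq_zero {α R : ℝ} (h : R < 1) : ballSum n α R = 0 := by
  refine ENNReal.tsum_eq_zero.2 fun ξ => if_neg ?_
  have := one_le_rho ξ
  linarith

/-- One dyadic step: on the shell `R/2 < ρ ≤ R` the summand is comparable to `R^α`, and the shell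
has at most a multiple of `R^n` points. Iterating it gives both the growth law for `α > -n` and
convergence for `α < -n`. -/
theorem exists_ballSum_le_half (n : ℕ) (α : ℝ) : ∃ D : ℝ, 0 < D ∧ ∀ R : ℝ, 1 ≤ R →
    ballSum n α R ≤ ballSum n α (R / 2) + ENNReal.ofReal (D * R ^ (α + n)) := by
  -- The box holds `(2⌊R⌋ + 1)^n ≤ (3R)^n` points, and `ρ^α ≤ 2^|α| R^α` on the shell.
  refine ⟨3 ^ n * 2 ^ |α|, by positivity, fun R hR => ?_⟩
  have hR0 : 0 < R := by linarith
  have key : ∀ ξ : Freq n, (if rho ξ ≤ R then ENNReal.ofReal (rho ξ ^ α) else 0) ≤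
      (if rho ξ ≤ R / 2 then ENNReal.ofReal (rho ξ ^ α) else 0) +
      (if ξ ∈ freqBox n ⌊R⌋₊ then ENNReal.ofReal (2 ^ |α| * R ^ α) else 0) := by
    intro ξ
    by_cases h1 : rho ξ ≤ R / 2
    · rw [if_pos h1, if_pos (by linarith)]
      exact le_self_add
    · by_cases h2 : rho ξ ≤ R
      · rw [if_pos h2, if_neg h1, if_pos (mem_freqBox h2), zero_add]
        refine ENNReal.ofReal_le_ofReal ?_
        rw [← div_le_iff₀ (by positivity), ← Real.div_rpow (rho_pos ξ).le hR0.le]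
        refine ratio_rpow_le α (by norm_num) ?_ ?_
        · rw [le_div_iff₀ hR0]; push Not at h1; linarith
        · rw [div_le_iff₀ hR0]; linarith
      · rw [if_neg h2]; exact zero_le
  refine (ENNReal.tsum_le_tsum key).trans ?_
  rw [ENNReal.tsum_add]
  refine add_le_add le_rfl ?_
  rw [tsum_eq_sum (s := freqBox n ⌊R⌋₊) (fun ξ h => if_neg h),
    Finset.sum_congr rfl (fun ξ h => if_pos h), Finset.sum_const, card_freqBox, nsmul_eq_mul,
    ← ENNReal.ofReal_natCast, ← ENNReal.ofReal_mul (Nat.cast_nonneg _)]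
  refine ENNReal.ofReal_le_ofReal ?_
  have h3 : (((2 * ⌊R⌋₊ + 1) ^ n : ℕ) : ℝ) ≤ 3 ^ n * R ^ n := by
    push_cast
    rw [← mul_pow]
    gcongr
    have := Nat.floor_le hR0.le
    linarith
  rw [Real.rpow_add hR0, Real.rpow_natCast]
  calc _ ≤ (3 ^ n * R ^ n) * (2 ^ |α| * R ^ α) := by gcongr
    _ = _ := by ring

theorem exists_ballSum_le {α : ℝ} (h : -(n : ℝ) < α) : ∃ C : ℝ, 0 < C ∧ ∀ R : ℝ, 0 < R →
    ballSum n α R ≤ ENNReal.ofReal (C * R ^ (α + n)) := by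
  obtain ⟨D, hD, hrec⟩ := exists_ballSum_le_half n α
  have hβ : 0 < α + n := by linarith
  have h2 : (2 : ℝ)⁻¹ ^ (α + n) < 1 := Real.rpow_lt_one (by norm_num) (by norm_num) hβ
  set q : ℝ := (2 : ℝ)⁻¹ ^ (α + n) with hq
  have hq' : 0 < 1 - q := by linarith
  have hq0 : 0 ≤ q := by positivity
  -- The fixed point of `C = q C + D`, the sum of the geometric series produced by halving `R` until
  -- it drops below `1`.
  refine ⟨D / (1 - q), by positivity, ?_⟩
  have key : ∀ (k : ℕ) (R : ℝ), 0 < R → R < 2 ^ k →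
      ballSum n α R ≤ ENNReal.ofReal (D / (1 - q) * R ^ (α + n)) := by
    intro k
    induction k with
    | zero => intro R _ h1; rw [ballSum_eq_zero (by simpa using h1)]; exact zero_le
    | succ k ih =>
      intro R hR h1
      rcases lt_or_ge R 1 with h3 | h3
      · rw [ballSum_eq_zero h3]; exact zero_le
      refine (hrec R h3).trans ?_
      refine (add_le_add_left (ih (R / 2) (by linarith) (by rw [pow_succ] at h1; linarith)) _).trans
        ?_
      rw [← ENNReal.ofReal_add (by positivity) (by positivity)]
      refine ENNReal.ofReal_le_ofReal (le_of_eq ?_)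
      rw [div_eq_mul_inv R, Real.mul_rpow hR.le (by norm_num), ← hq]
      field_simp
      ring
  intro R hR
  obtain ⟨k, hk⟩ := pow_unbounded_of_one_lt R (one_lt_two)
  exact key k R hR hk

theorem exists_tsum_rho_rpow_le {α : ℝ} (h : α < -(n : ℝ)) : ∃ C : ℝ, 0 < C ∧
    ∑' ξ : Freq n, ENNReal.ofReal (rho ξ ^ α) ≤ ENNReal.ofReal C := by
  obtain ⟨D, hD, hrec⟩ := exists_ballSum_le_half n α
  have hβ : α + n < 0 := by linarith
  set q : ℝ := (2 : ℝ)⁻¹ ^ (α + n) with hq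
  have h2 : 1 < q := Real.one_lt_rpow_of_pos_of_lt_one_of_neg (by norm_num) (by norm_num) hβ
  have hq' : 0 < q - 1 := by linarith
  set E := D / (q - 1) with hE
  have hE0 : 0 < E := by positivity
  -- The bound `E q - E R^{α+n}` reproduces itself under the dyadic step since `E (q - 1) = D`. It
  -- is nonnegative for `R ≥ 1/2`, the smallest radius that halving some `R ≥ 1` can reach.
  refine ⟨E * q, by positivity, ?_⟩
  have key : ∀ (k : ℕ) (R : ℝ), 2⁻¹ ≤ R → R < 2 ^ k →
      ballSum n α R ≤ ENNReal.ofReal (E * q - E * R ^ (α + n)) := by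
    intro k
    induction k with
    | zero => intro R _ h1; rw [ballSum_eq_zero (by simpa using h1)]; exact zero_le
    | succ k ih =>
      intro R hR h1
      rcases lt_or_ge R 1 with h3 | h3
      · rw [ballSum_eq_zero h3]; exact zero_le
      refine (hrec R h3).trans ?_
      refine (add_le_add_left (ih (R / 2) (by linarith) (by rw [pow_succ] at h1; linarith)) _).trans
        ?_
      have h4 : (R / 2) ^ (α + n) ≤ q :=
        Real.rpow_le_rpow_of_nonpos (by norm_num) (by linarith) hβ.le
      rw [← ENNReal.ofReal_add (by nlinarith) (by positivity)]
      refine ENNReal.ofReal_le_ofReal (le_of_eq ?_)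
      rw [div_eq_mul_inv R, Real.mul_rpow (by linarith) (by norm_num), ← hq, hE]
      field_simp
      ring
  rw [ENNReal.tsum_eq_iSup_sum]
  refine iSup_le fun S => ?_
  obtain ⟨k, hk⟩ := pow_unbounded_of_one_lt (∑ ξ ∈ S, rho ξ + 1) (one_lt_two)
  have h0 : 0 ≤ ∑ ξ ∈ S, rho ξ := Finset.sum_nonneg fun ξ _ => (rho_pos ξ).le
  refine le_trans ?_ ((key k (∑ ξ ∈ S, rho ξ + 1) (by linarith [h0]) hk).trans
    (ENNReal.ofReal_le_ofReal (by
      have : 0 ≤ (∑ ξ ∈ S, rho ξ + 1) ^ (α + n) := by positivity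
      nlinarith)))
  refine le_trans (Finset.sum_le_sum fun ξ hξ => ?_) (ENNReal.sum_le_tsum S)
  rw [if_pos]
  have := Finset.single_le_sum (f := fun ξ => rho ξ) (fun i _ => (rho_pos i).le) hξ
  linarith

theorem summable_rho_rpow {α : ℝ} (h : α < -(n : ℝ)) : Summable fun ξ : Freq n => rho ξ ^ α := by
  obtain ⟨C, -, hC⟩ := exists_tsum_rho_rpow_le h
  have h1 := ENNReal.summable_toReal (hC.trans_lt ENNReal.ofReal_lt_top).ne
  exact h1.congr fun ξ => ENNReal.toReal_ofReal (Real.rpow_nonneg (rho_pos ξ).le _)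

/-! ### Bilinear `ℓ²` bounds for weighted convolutions -/

theorem sq_tsum_mul_le {ι : Type*} (f g : ι → ℝ≥0∞) :
    (∑' i, f i * g i) ^ 2 ≤ (∑' i, f i ^ 2) * ∑' i, g i ^ 2 := by
  let _ : MeasurableSpace ι := ⊤
  have h := ENNReal.lintegral_mul_le_Lp_mul_Lq (MeasureTheory.Measure.count (α := ι))
    Real.HolderConjugate.two_two (f := f) (g := g)
    (measurable_from_top).aemeasurable (measurable_from_top).aemeasurable
  simp only [MeasureTheory.lintegral_count, Pi.mul_apply] at h
  refine (pow_le_pow_left₀ zero_le h 2).trans (le_of_eq ?_)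
  rw [mul_pow, ← ENNReal.rpow_natCast, ← ENNReal.rpow_natCast, ← ENNReal.rpow_mul,
    ← ENNReal.rpow_mul]
  simp

theorem sq_add_le (a b : ℝ≥0∞) : (a + b) ^ 2 ≤ 2 * (a ^ 2 + b ^ 2) := by
  have h := ENNReal.rpow_add_le_mul_rpow_add_rpow a b (p := 2) (by norm_num)
  norm_num at h
  exact h

/-- The convolution of `f` and `g` with weight `K (ξ, η)` at the frequencies `ξ + η = ζ`. -/
def weightedConv (K : Freq n → Freq n → ℝ≥0∞) (f g : Freq n → ℝ≥0∞) (ζ : Freq n) : ℝ≥0∞ :=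
  ∑' ξ, K ξ (ζ - ξ) * f ξ * g (ζ - ξ)

/-- The weighted convolution with kernel `K` maps `ℓ² × ℓ²` boundedly to `ℓ²`. -/
def ConvBounded (K : Freq n → Freq n → ℝ≥0∞) : Prop :=
  ∃ C : ℝ≥0∞, C ≠ ⊤ ∧ ∀ f g : Freq n → ℝ≥0∞,
    ∑' ζ, weightedConv K f g ζ ^ 2 ≤ C * ((∑' ξ, f ξ ^ 2) * ∑' ξ, g ξ ^ 2)

theorem ConvBounded.mono {K L : Freq n → Freq n → ℝ≥0∞} (hL : ConvBounded L)
    (h : ∀ ξ η, K ξ η ≤ L ξ η) : ConvBounded K := by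
  obtain ⟨C, hC, hb⟩ := hL
  refine ⟨C, hC, fun f g => le_trans (ENNReal.tsum_le_tsum fun ζ => ?_) (hb f g)⟩
  unfold weightedConv
  gcongr
  exact h _ _

theorem ConvBounded.add {K L : Freq n → Freq n → ℝ≥0∞} (hK : ConvBounded K) (hL : ConvBounded L) :
    ConvBounded (fun ξ η => K ξ η + L ξ η) := by
  obtain ⟨C, hC, hb⟩ := hK
  obtain ⟨D, hD, hb'⟩ := hL
  refine ⟨2 * (C + D), by finiteness, fun f g => ?_⟩
  have h : ∀ ζ, weightedConv (fun ξ η => K ξ η + L ξ η) f g ζ ^ 2 ≤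
      2 * (weightedConv K f g ζ ^ 2 + weightedConv L f g ζ ^ 2) := fun ζ => by
    have h1 : weightedConv (fun ξ η => K ξ η + L ξ η) f g ζ =
        weightedConv K f g ζ + weightedConv L f g ζ := by
      unfold weightedConv
      rw [← ENNReal.tsum_add]
      exact tsum_congr fun ξ => by ring
    rw [h1]
    exact sq_add_le _ _
  refine (ENNReal.tsum_le_tsum h).trans ?_
  rw [ENNReal.tsum_mul_left, ENNReal.tsum_add, mul_assoc, add_mul]
  gcongr
  · exact hb f g
  · exact hb' f g

theorem ConvBounded.const_mul {K : Freq n → Freq n → ℝ≥0∞} (hK : ConvBounded K) {M : ℝ≥0∞}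
    (hM : M ≠ ⊤) : ConvBounded (fun ξ η => M * K ξ η) := by
  obtain ⟨C, hC, hb⟩ := hK
  refine ⟨M ^ 2 * C, by finiteness, fun f g => ?_⟩
  have h1 : ∀ ζ, weightedConv (fun ξ η => M * K ξ η) f g ζ = M * weightedConv K f g ζ := fun ζ => by
    unfold weightedConv
    rw [← ENNReal.tsum_mul_left]
    exact tsum_congr fun ξ => by ring
  simp only [h1, mul_pow]
  rw [ENNReal.tsum_mul_left, mul_assoc]
  gcongr
  exact hb f g

theorem ConvBounded.swap {K : Freq n → Freq n → ℝ≥0∞} (hK : ConvBounded K) :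
    ConvBounded (fun ξ η => K η ξ) := by
  obtain ⟨C, hC, hb⟩ := hK
  refine ⟨C, hC, fun f g => ?_⟩
  have h1 : ∀ ζ, weightedConv (fun ξ η => K η ξ) f g ζ = weightedConv K g f ζ := fun ζ => by
    unfold weightedConv
    rw [← (Equiv.subLeft ζ).tsum_eq]
    exact tsum_congr fun ξ => by simp [mul_right_comm]
  simp only [h1]
  rw [mul_comm (∑' ξ, f ξ ^ 2)]
  exact hb g f

theorem tsum_tsum_sub_left (F : Freq n → Freq n → ℝ≥0∞) :
    ∑' ζ, ∑' ξ, F ξ (ζ - ξ) = ∑' ξ, ∑' η, F ξ η := by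
  rw [ENNReal.tsum_comm]
  exact tsum_congr fun ξ => (Equiv.subRight ξ).tsum_eq (F ξ)

/-- Cauchy–Schwarz at a fixed output frequency, with the kernel as one factor and `f g` as the
other; the remaining double sum factorises. -/
theorem convBounded_of_output {K : Freq n → Freq n → ℝ≥0∞} {C : ℝ≥0∞} (hC : C ≠ ⊤)
    (h : ∀ ζ, ∑' ξ, K ξ (ζ - ξ) ^ 2 ≤ C) : ConvBounded K := by
  refine ⟨C, hC, fun f g => ?_⟩
  have h1 : ∀ ζ, weightedConv K f g ζ ^ 2 ≤ C * ∑' ξ, f ξ ^ 2 * g (ζ - ξ) ^ 2 := fun ζ => by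
    have h2 := sq_tsum_mul_le (fun ξ => K ξ (ζ - ξ)) (fun ξ => f ξ * g (ζ - ξ))
    simp only [mul_pow, ← mul_assoc] at h2
    exact h2.trans (mul_le_mul_left (h ζ) _)
  refine (ENNReal.tsum_le_tsum h1).trans ?_
  rw [ENNReal.tsum_mul_left, tsum_tsum_sub_left (fun ξ η => f ξ ^ 2 * g η ^ 2)]
  simp only [ENNReal.tsum_mul_left, ENNReal.tsum_mul_right]
  exact le_rfl

/-- Cauchy–Schwarz with `g` split off, whose sum does not depend on the output; summing over outputs
then only meets the kernel at a fixed first frequency. -/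
theorem convBounded_of_input {K : Freq n → Freq n → ℝ≥0∞} {C : ℝ≥0∞} (hC : C ≠ ⊤)
    (h : ∀ ξ, ∑' η, K ξ η ^ 2 ≤ C) : ConvBounded K := by
  refine ⟨C, hC, fun f g => ?_⟩
  have h1 : ∀ ζ, weightedConv K f g ζ ^ 2 ≤
      (∑' ξ, K ξ (ζ - ξ) ^ 2 * f ξ ^ 2) * ∑' ξ, g ξ ^ 2 := fun ζ => by
    have h2 := sq_tsum_mul_le (fun ξ => K ξ (ζ - ξ) * f ξ) (fun ξ => g (ζ - ξ))
    simp only [mul_pow] at h2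
    exact h2.trans_eq (congrArg _ ((Equiv.subLeft ζ).tsum_eq fun ξ => g ξ ^ 2))
  refine (ENNReal.tsum_le_tsum h1).trans ?_
  rw [ENNReal.tsum_mul_right, tsum_tsum_sub_left (fun ξ η => K ξ η ^ 2 * f ξ ^ 2), ← mul_assoc,
    ← ENNReal.tsum_mul_left (a := C)]
  refine mul_le_mul_left (ENNReal.tsum_le_tsum fun ξ => ?_) _
  rw [ENNReal.tsum_mul_right]
  exact mul_le_mul_left (h ξ) _

/-! ### Product laws: kernel estimates by frequency regions -/

/-- The kernel of the product `H^{s₁} × H^{s₂} → H^t`. -/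
def productKernel (s₁ s₂ t : ℝ) (ξ η : Freq n) : ℝ≥0∞ :=
  ENNReal.ofReal (rho (ξ + η) ^ t * rho ξ ^ (-s₁) * rho η ^ (-s₂))

theorem ofReal_rpow_sq {x : ℝ} (hx : 0 ≤ x) (s : ℝ) :
    ENNReal.ofReal (x ^ s) ^ 2 = ENNReal.ofReal (x ^ (2 * s)) := by
  rw [← ENNReal.ofReal_pow (by positivity), mul_comm, Real.rpow_mul hx, Real.rpow_two]

/-- Low frequencies in the first factor. -/
theorem convBounded_low {s c : ℝ} (hc : 0 < c) (hs : s < (n : ℝ) / 2) :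
    ConvBounded fun ξ η : Freq n => if rho ξ ≤ c * rho (ξ + η) then
      ENNReal.ofReal (rho (ξ + η) ^ (s - (n : ℝ) / 2) * rho ξ ^ (-s)) else 0 := by
  -- At a fixed output `ζ`, `∑ ρ(ξ)^{-2s}` over `ρ(ξ) ≤ c ρ(ζ)` grows like `ρ(ζ)^{n-2s}`, which
  -- cancels the outer weight; `s < n/2` is what allows this.
  obtain ⟨C, hC, hb⟩ := exists_ballSum_le (n := n) (α := -(2 * s)) (by linarith)
  refine convBounded_of_output (C := ENNReal.ofReal (C * c ^ (-(2 * s) + n))) (by finiteness)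
    fun ζ => ?_
  have hz := rho_pos ζ
  have h1 : ∀ ξ : Freq n, (if rho ξ ≤ c * rho (ξ + (ζ - ξ)) then
      ENNReal.ofReal (rho (ξ + (ζ - ξ)) ^ (s - (n : ℝ) / 2) * rho ξ ^ (-s)) else 0) ^ 2 =
      ENNReal.ofReal (rho ζ ^ (2 * s - n)) *
        (if rho ξ ≤ c * rho ζ then ENNReal.ofReal (rho ξ ^ (-(2 * s))) else 0) := by
    intro ξ
    rw [add_sub_cancel]
    split_ifs
    · rw [ENNReal.ofReal_mul (by positivity), mul_pow, ofReal_rpow_sq hz.le,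
        ofReal_rpow_sq (rho_pos ξ).le]
      ring_nf
    · simp
  simp only [h1]
  rw [ENNReal.tsum_mul_left]
  refine (mul_le_mul_right (hb (c * rho ζ) (by positivity)) _).trans ?_
  rw [← ENNReal.ofReal_mul (by positivity)]
  refine ENNReal.ofReal_le_ofReal (le_of_eq ?_)
  rw [Real.mul_rpow hc.le hz.le]
  have : rho ζ ^ (2 * s - n) * rho ζ ^ (-(2 * s) + n) = 1 := by
    rw [← Real.rpow_add hz]
    simp
  linear_combination C * c ^ (-(2 * s) + n) * this

/-- Comparable frequencies. -/
theorem convBounded_high {s c : ℝ} (hc : 0 < c) (hs : 0 < s) :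
    ConvBounded fun ξ η : Freq n => if rho (ξ + η) ≤ c * rho ξ then
      ENNReal.ofReal (rho (ξ + η) ^ (s - (n : ℝ) / 2) * rho ξ ^ (-s)) else 0 := by
  -- Now the input `ξ` is fixed and the output runs over a ball: `∑ ρ(ζ)^{2s-n}` grows like
  -- `ρ(ξ)^{2s}`, and `s > 0` is needed.
  obtain ⟨C, hC, hb⟩ := exists_ballSum_le (n := n) (α := 2 * s - n) (by linarith)
  refine convBounded_of_input (C := ENNReal.ofReal (C * c ^ (2 * s))) (by finiteness)
    fun ξ => ?_
  have hz := rho_pos ξ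
  have h1 : ∀ η : Freq n, (if rho (ξ + η) ≤ c * rho ξ then
      ENNReal.ofReal (rho (ξ + η) ^ (s - (n : ℝ) / 2) * rho ξ ^ (-s)) else 0) ^ 2 =
      ENNReal.ofReal (rho ξ ^ (-(2 * s))) *
        (if rho (ξ + η) ≤ c * rho ξ then ENNReal.ofReal (rho (ξ + η) ^ (2 * s - n)) else 0) := by
    intro η
    have := rho_pos (ξ + η)
    split_ifs
    · rw [ENNReal.ofReal_mul (by positivity), mul_pow, ofReal_rpow_sq this.le,
        ofReal_rpow_sq hz.le]
      ring_nf
    · simp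
  simp only [h1]
  rw [ENNReal.tsum_mul_left]
  have h2 := (Equiv.addLeft ξ).tsum_eq
    (fun ζ => if rho ζ ≤ c * rho ξ then ENNReal.ofReal (rho ζ ^ (2 * s - n)) else 0)
  refine (mul_le_mul_right (h2.trans_le (hb (c * rho ξ) (by positivity))) _).trans ?_
  rw [← ENNReal.ofReal_mul (by positivity)]
  refine ENNReal.ofReal_le_ofReal (le_of_eq ?_)
  rw [Real.mul_rpow hc.le hz.le, sub_add_cancel]
  have : rho ξ ^ (-(2 * s)) * rho ξ ^ (2 * s) = 1 := by
    rw [← Real.rpow_add hz]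
    simp
  linear_combination C * c ^ (2 * s) * this

/-- If `x` and `y` are comparable, powers of `y` can be traded for powers of `x`. -/
theorem rpow_le_of_comparable {x y M : ℝ} (s : ℝ) (hx : 0 < x) (hy : 0 < y) (hM : 1 ≤ M)
    (h1 : x ≤ M * y) (h2 : y ≤ M * x) : y ^ s ≤ M ^ |s| * x ^ s := by
  rw [← div_le_iff₀ (by positivity), ← Real.div_rpow hy.le hx.le]
  have hM0 : 0 < M := by linarith
  refine ratio_rpow_le s hM ?_ ?_
  · rw [inv_eq_one_div, div_le_div_iff₀ hM0 hx]; linarith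
  · rw [div_le_iff₀ hx]; exact h2

theorem rho_le_rho_add_add (ξ η : Freq n) : rho η ≤ rho (ξ + η) + rho ξ := by
  have := rho_add_le (ξ + η) (-ξ)
  rwa [rho_neg, add_comm ξ η, add_neg_cancel_right, add_comm η ξ] at this

/-- When `η` dominates, `ρ(ξ+η)` and `ρ(η)` are comparable, so `ρ(η)^{-s₂}` merges with the output
weight and only `s₁` remains. -/
theorem productKernel_le_low {s₁ s₂ : ℝ} (ξ η : Freq n) (h : 4 * rho ξ ≤ rho η) :
    productKernel s₁ s₂ (s₁ + s₂ - (n : ℝ) / 2) ξ η ≤ ENNReal.ofReal (4 ^ |s₂|) *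
      (if rho ξ ≤ 1 * rho (ξ + η) then
        ENNReal.ofReal (rho (ξ + η) ^ (s₁ - (n : ℝ) / 2) * rho ξ ^ (-s₁)) else 0) := by
  have h1 := rho_le_rho_add_add ξ η
  have h2 := rho_add_le ξ η
  have hx := rho_pos ξ
  have hy := rho_pos η
  have hz := rho_pos (ξ + η)
  rw [if_pos (by linarith), ← ENNReal.ofReal_mul (by positivity)]
  refine ENNReal.ofReal_le_ofReal ?_
  have h3 := rpow_le_of_comparable (M := 4) (-s₂) hz hy (by norm_num) (by linarith) (by linarith)
  rw [abs_neg] at h3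
  calc _ ≤ rho (ξ + η) ^ (s₁ + s₂ - (n : ℝ) / 2) * rho ξ ^ (-s₁) *
        (4 ^ |s₂| * rho (ξ + η) ^ (-s₂)) := by gcongr
    _ = _ := by
      rw [show s₁ - (n : ℝ) / 2 = (s₁ + s₂ - (n : ℝ) / 2) + -s₂ by ring, Real.rpow_add hz]
      ring

/-- For comparable inputs both input weights merge into `ρ(ξ)^{-(s₁+s₂)}`, while the output may be
arbitrarily low; hence the condition on the sum `s₁ + s₂`. -/
theorem productKernel_le_high {s₁ s₂ : ℝ} (ξ η : Freq n) (h : rho η ≤ 4 * rho ξ)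
    (h' : rho ξ ≤ 4 * rho η) :
    productKernel s₁ s₂ (s₁ + s₂ - (n : ℝ) / 2) ξ η ≤ ENNReal.ofReal (4 ^ |s₂|) *
      (if rho (ξ + η) ≤ 5 * rho ξ then
        ENNReal.ofReal (rho (ξ + η) ^ (s₁ + s₂ - (n : ℝ) / 2) * rho ξ ^ (-(s₁ + s₂))) else 0) := by
  have h2 := rho_add_le ξ η
  have hx := rho_pos ξ
  have hy := rho_pos η
  have hz := rho_pos (ξ + η)
  rw [if_pos (by linarith), ← ENNReal.ofReal_mul (by positivity)]
  refine ENNReal.ofReal_le_ofReal ?_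
  have h3 := rpow_le_of_comparable (M := 4) (-s₂) hx hy (by norm_num) h' h
  rw [abs_neg] at h3
  calc _ ≤ rho (ξ + η) ^ (s₁ + s₂ - (n : ℝ) / 2) * rho ξ ^ (-s₁) *
        (4 ^ |s₂| * rho ξ ^ (-s₂)) := by gcongr
    _ = _ := by
      rw [neg_add, Real.rpow_add hx]
      ring

theorem productKernel_swap (s₁ s₂ t : ℝ) (ξ η : Freq n) :
    productKernel s₁ s₂ t ξ η = productKernel s₂ s₁ t η ξ := by
  unfold productKernel
  rw [add_comm ξ η, mul_right_comm]

/-- The three regions `ξ` low, `η` low and comparable use the three hypotheses in turn; the second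
is the first with the factors exchanged. -/
theorem convBounded_productKernel_subcritical {s₁ s₂ : ℝ} (h1 : s₁ < (n : ℝ) / 2)
    (h2 : s₂ < (n : ℝ) / 2) (h : 0 < s₁ + s₂) :
    ConvBounded (productKernel (n := n) s₁ s₂ (s₁ + s₂ - (n : ℝ) / 2)) := by
  have hL := (convBounded_low (n := n) one_pos h1).const_mul
    (M := ENNReal.ofReal (4 ^ |s₂|)) ENNReal.ofReal_ne_top
  have hR := ((convBounded_low (n := n) one_pos h2).const_mul
    (M := ENNReal.ofReal (4 ^ |s₁|)) ENNReal.ofReal_ne_top).swap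
  have hM := (convBounded_high (n := n) (c := 5) (by norm_num) h).const_mul
    (M := ENNReal.ofReal (4 ^ |s₂|)) ENNReal.ofReal_ne_top
  refine ((hL.add hR).add hM).mono fun ξ η => ?_
  rcases le_total (4 * rho ξ) (rho η) with h3 | h3
  · exact (productKernel_le_low ξ η h3).trans (le_add_right le_self_add)
  rcases le_total (4 * rho η) (rho ξ) with h4 | h4
  · rw [productKernel_swap, add_comm s₁]
    exact (productKernel_le_low η ξ h4).trans (le_add_right le_add_self)
  · exact (productKernel_le_high ξ η h3 h4).trans le_add_self

/-- Since `s₂ ≥ 0`, the output weight is absorbed by the larger input. What remains is at most the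
smaller input's `ρ^{-s₁}`, up to a constant; `s₂ ≤ s₁` is used when the larger input is the first.
-/
theorem convBounded_productKernel_supercritical {s₁ s₂ : ℝ} (h1 : (n : ℝ) / 2 < s₁)
    (h2 : 0 ≤ s₂) (h : s₂ ≤ s₁) : ConvBounded (productKernel (n := n) s₁ s₂ s₂) := by
  obtain ⟨C, hC, hb⟩ := exists_tsum_rho_rpow_le (n := n) (α := 2 * -s₁) (by linarith)
  have hK : ConvBounded fun ξ _ : Freq n => ENNReal.ofReal (rho ξ ^ (-s₁)) :=
    convBounded_of_output (C := ENNReal.ofReal C) ENNReal.ofReal_ne_top fun ζ => by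
      simpa only [ofReal_rpow_sq (rho_pos _).le] using hb
  refine ((hK.add hK.swap).const_mul (M := ENNReal.ofReal (2 ^ s₂)) (by finiteness)).mono
    fun ξ η => ?_
  have hx := rho_pos ξ
  have hy := rho_pos η
  have hz := rho_pos (ξ + η)
  have hadd := rho_add_le ξ η
  rw [mul_add, ← ENNReal.ofReal_mul (by positivity), ← ENNReal.ofReal_mul (by positivity)]
  rcases le_total (rho ξ) (rho η) with h3 | h3
  · refine le_trans (ENNReal.ofReal_le_ofReal ?_) le_self_add
    calc _ ≤ (2 * rho η) ^ s₂ * rho ξ ^ (-s₁) * rho η ^ (-s₂) := by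
          gcongr
          linarith
      _ = _ := by
        have : rho η ^ s₂ * rho η ^ (-s₂) = 1 := by rw [← Real.rpow_add hy]; simp
        rw [Real.mul_rpow (by norm_num) hy.le]
        linear_combination 2 ^ s₂ * rho ξ ^ (-s₁) * this
  · refine le_trans (ENNReal.ofReal_le_ofReal ?_) le_add_self
    calc _ ≤ (2 * rho ξ) ^ s₂ * rho ξ ^ (-s₁) * rho η ^ (-s₂) := by
          gcongr
          linarith
      _ = 2 ^ s₂ * (rho ξ ^ (s₂ - s₁) * rho η ^ (-s₂)) := by
        rw [Real.mul_rpow (by norm_num) hx.le, sub_eq_add_neg, Real.rpow_add hx]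
        ring
      _ ≤ 2 ^ s₂ * (rho η ^ (s₂ - s₁) * rho η ^ (-s₂)) := by
        have := Real.rpow_le_rpow_of_nonpos hy h3 (by linarith : s₂ - s₁ ≤ 0)
        gcongr
      _ = _ := by
        rw [← Real.rpow_add hy]
        ring_nf

/-! ### Product bounds in Sobolev norms of coefficient moduli -/

/-- The squared `H^s` norm of a sequence of moduli of Fourier coefficients. -/
def sobSq (s : ℝ) (f : Freq n → ℝ≥0∞) : ℝ≥0∞ :=
  ∑' ξ, ENNReal.ofReal (rho ξ ^ (2 * s)) * f ξ ^ 2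

/-- Convolution of nonnegative sequences. -/
def absConv (f g : Freq n → ℝ≥0∞) (ζ : Freq n) : ℝ≥0∞ := ∑' ξ, f ξ * g (ζ - ξ)

/-- Pointwise multiplication is bounded `H^{s₁} × H^{s₂} → H^t`, at the level of the moduli of
Fourier coefficients. -/
def ProductBound (n : ℕ) (s₁ s₂ t : ℝ) : Prop :=
  ∃ C : ℝ≥0∞, C ≠ ⊤ ∧ ∀ f g : Freq n → ℝ≥0∞,
    sobSq t (absConv f g) ≤ C * (sobSq s₁ f * sobSq s₂ g)

theorem ofReal_rho_rpow_mul_neg (ξ : Freq n) (s : ℝ) :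
    ENNReal.ofReal (rho ξ ^ (-s)) * ENNReal.ofReal (rho ξ ^ s) = 1 := by
  have := rho_pos ξ
  rw [← ENNReal.ofReal_mul (by positivity), ← Real.rpow_add this]
  simp

theorem ofReal_rho_rpow_ne_zero (ξ : Freq n) (s : ℝ) : ENNReal.ofReal (rho ξ ^ s) ≠ 0 := by
  have := rho_pos ξ
  have : 0 < rho ξ ^ s := by positivity
  simpa using this

theorem ConvBounded.productBound {s₁ s₂ t : ℝ}
    (h : ConvBounded (productKernel (n := n) s₁ s₂ t)) : ProductBound n s₁ s₂ t := by
  obtain ⟨C, hC, hb⟩ := h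
  refine ⟨C, hC, fun f g => ?_⟩
  have h1 := hb (fun ξ => ENNReal.ofReal (rho ξ ^ s₁) * f ξ)
    (fun ξ => ENNReal.ofReal (rho ξ ^ s₂) * g ξ)
  simp only [mul_pow, ofReal_rpow_sq (rho_pos _).le] at h1
  refine le_trans (ENNReal.tsum_le_tsum fun ζ => le_of_eq ?_) h1
  rw [← ofReal_rpow_sq (rho_pos ζ).le, ← mul_pow]
  congr 1
  unfold absConv weightedConv productKernel
  rw [← ENNReal.tsum_mul_left]
  refine tsum_congr fun ξ => ?_
  have := rho_pos ξ
  have := rho_pos ζ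
  have e1 := ofReal_rho_rpow_mul_neg ξ s₁
  have e2 := ofReal_rho_rpow_mul_neg (ζ - ξ) s₂
  rw [add_sub_cancel, ENNReal.ofReal_mul (by positivity), ENNReal.ofReal_mul (by positivity)]
  calc _ = ENNReal.ofReal (rho ζ ^ t) * (f ξ * g (ζ - ξ)) * 1 * 1 := by ring
    _ = _ := by
      nth_rewrite 1 [← e1]
      rw [← e2]
      ring

theorem productBound_subcritical {s₁ s₂ : ℝ} (h1 : s₁ < (n : ℝ) / 2) (h2 : s₂ < (n : ℝ) / 2)
    (h : 0 < s₁ + s₂) : ProductBound n s₁ s₂ (s₁ + s₂ - (n : ℝ) / 2) :=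
  (convBounded_productKernel_subcritical h1 h2 h).productBound

theorem productBound_supercritical {s₁ s₂ : ℝ} (h1 : (n : ℝ) / 2 < s₁) (h2 : 0 ≤ s₂)
    (h : s₂ ≤ s₁) : ProductBound n s₁ s₂ s₂ :=
  (convBounded_productKernel_supercritical h1 h2 h).productBound

theorem sobSq_mono {s : ℝ} {f g : Freq n → ℝ≥0∞} (h : ∀ ξ, f ξ ≤ g ξ) : sobSq s f ≤ sobSq s g :=
  ENNReal.tsum_le_tsum fun ξ => by gcongr; exact h ξ

theorem sobSq_const_mul (s : ℝ) (c : ℝ≥0∞) (f : Freq n → ℝ≥0∞) :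
    sobSq s (fun ξ => c * f ξ) = c ^ 2 * sobSq s f := by
  unfold sobSq
  rw [← ENNReal.tsum_mul_left]
  exact tsum_congr fun ξ => by ring

theorem sq_finsetSum_le {ι : Type*} [Fintype ι] (x : ι → ℝ≥0∞) :
    (∑ i, x i) ^ 2 ≤ Fintype.card ι * ∑ i, x i ^ 2 := by
  have h := sq_tsum_mul_le (fun _ : ι => (1 : ℝ≥0∞)) x
  simpa [tsum_fintype] using h

theorem sobSq_sum_le {ι : Type*} [Fintype ι] (s : ℝ) (f : ι → Freq n → ℝ≥0∞) :
    sobSq s (fun ξ => ∑ i, f i ξ) ≤ Fintype.card ι * ∑ i, sobSq s (f i) := by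
  unfold sobSq
  rw [← Summable.tsum_finsetSum fun _ _ => ENNReal.summable, ← ENNReal.tsum_mul_left]
  refine ENNReal.tsum_le_tsum fun ξ => ?_
  rw [← Finset.mul_sum, mul_left_comm]
  gcongr
  exact sq_finsetSum_le _

theorem rho_mul_sobSq (s : ℝ) (f : Freq n → ℝ≥0∞) :
    sobSq (s - 1) (fun ξ => ENNReal.ofReal (rho ξ) * f ξ) = sobSq s f := by
  refine tsum_congr fun ξ => ?_
  have := rho_pos ξ
  rw [mul_pow, ← mul_assoc, ← ENNReal.ofReal_pow this.le, ← ENNReal.ofReal_mul (by positivity),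
    ← Real.rpow_two, ← Real.rpow_add this]
  ring_nf

theorem ne_top_of_sobSq {s : ℝ} {f : Freq n → ℝ≥0∞} (h : sobSq s f ≠ ⊤) (ξ : Freq n) :
    f ξ ≠ ⊤ := by
  have h1 := ENNReal.ne_top_of_tsum_ne_top h ξ
  intro h2
  rw [h2] at h1
  refine h1 ?_
  rw [ENNReal.top_pow two_ne_zero, ENNReal.mul_top (ofReal_rho_rpow_ne_zero _ _)]

/-- The duality of `H^s` and `H^{-s}`, by Cauchy–Schwarz. -/
theorem tsum_mul_ne_top {s : ℝ} {f g : Freq n → ℝ≥0∞} (hf : sobSq s f ≠ ⊤)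
    (hg : sobSq (-s) g ≠ ⊤) : ∑' ξ, f ξ * g ξ ≠ ⊤ := by
  have h := sq_tsum_mul_le (fun ξ => ENNReal.ofReal (rho ξ ^ s) * f ξ)
    (fun ξ => ENNReal.ofReal (rho ξ ^ (-s)) * g ξ)
  simp only [mul_pow, ofReal_rpow_sq (rho_pos _).le] at h
  have h1 : ∀ ξ : Freq n, ENNReal.ofReal (rho ξ ^ s) * f ξ * (ENNReal.ofReal (rho ξ ^ (-s)) * g ξ)
      = f ξ * g ξ := fun ξ => by
    have := ofReal_rho_rpow_mul_neg ξ s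
    calc _ = (ENNReal.ofReal (rho ξ ^ (-s)) * ENNReal.ofReal (rho ξ ^ s)) * (f ξ * g ξ) := by ring
      _ = _ := by rw [this, one_mul]
  simp only [h1] at h
  intro h2
  rw [h2, ENNReal.top_pow two_ne_zero] at h
  exact ENNReal.mul_ne_top hf hg (top_le_iff.1 h)

/-! ### Complex convolutions and the double series over frequency pairs -/

/-- Convolution of complex sequences. -/
def conv (a b : Freq n → ℂ) (ζ : Freq n) : ℂ := ∑' ξ, a ξ * b (ζ - ξ)

/-- The moduli of a complex sequence. -/
def moduli (a : Freq n → ℂ) (ξ : Freq n) : ℝ≥0∞ := ‖a ξ‖ₑ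

theorem summable_of_tsum_enorm_ne_top {ι : Type*} {f : ι → ℂ} (h : ∑' i, ‖f i‖ₑ ≠ ⊤) :
    Summable f := by
  refine Summable.of_norm ?_
  exact (ENNReal.summable_toReal h).congr fun i => by simp

theorem enorm_tsum_le {ι : Type*} (f : ι → ℂ) : ‖∑' i, f i‖ₑ ≤ ∑' i, ‖f i‖ₑ := by
  by_cases h : ∑' i, ‖f i‖ₑ = ⊤
  · rw [h]; exact le_top
  · have h1 := ENNReal.summable_toReal h
    have h2 := norm_tsum_le_tsum_norm (f := f) (h1.congr fun i => by simp)
    rw [← ofReal_norm]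
    refine (ENNReal.ofReal_le_ofReal h2).trans ?_
    rw [ENNReal.ofReal_tsum_of_nonneg (fun _ => norm_nonneg _) (h1.congr fun i => by simp)]
    simp

theorem moduli_conv_le (a b : Freq n → ℂ) (ζ : Freq n) :
    moduli (conv a b) ζ ≤ absConv (moduli a) (moduli b) ζ := by
  refine (enorm_tsum_le _).trans (le_of_eq (tsum_congr fun ξ => ?_))
  rw [enorm_mul]
  rfl

theorem summable_conv {a b : Freq n → ℂ} {ζ : Freq n}
    (h : absConv (moduli a) (moduli b) ζ ≠ ⊤) : Summable fun ξ => a ξ * b (ζ - ξ) := by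
  refine summable_of_tsum_enorm_ne_top ?_
  simp only [enorm_mul]
  exact h

theorem ProductBound.absConv_ne_top {s₁ s₂ t : ℝ} (h : ProductBound n s₁ s₂ t)
    {f g : Freq n → ℝ≥0∞} (hf : sobSq s₁ f ≠ ⊤) (hg : sobSq s₂ g ≠ ⊤) :
    sobSq t (absConv f g) ≠ ⊤ := by
  obtain ⟨C, hC, hb⟩ := h
  exact ne_top_of_le_ne_top (by finiteness) (hb f g)

/-- Pairing of a convolution with a test sequence, as a sum over pairs of frequencies. -/
theorem ProductBound.hasSum_pairing {s₁ s₂ t : ℝ} (h : ProductBound n s₁ s₂ t)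
    {a b ψ : Freq n → ℂ} (ha : sobSq s₁ (moduli a) ≠ ⊤) (hb : sobSq s₂ (moduli b) ≠ ⊤)
    (hψ : sobSq (-t) (moduli ψ) ≠ ⊤) :
    HasSum (fun p : Freq n × Freq n => a p.1 * b p.2 * ψ (p.1 + p.2))
      (∑' ζ, conv a b ζ * ψ ζ) := by
  have h0 := h.absConv_ne_top ha hb
  have h1 := tsum_mul_ne_top h0 hψ
  let e : Freq n × Freq n ≃ Freq n × Freq n :=
    { toFun := fun p => (p.2, p.1 - p.2)
      invFun := fun p => (p.1 + p.2, p.1)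
      left_inv := fun p => by simp
      right_inv := fun p => by simp }
  rw [← e.hasSum_iff]
  -- Absolute summability: the sum of moduli is the pairing of `absConv`, which lies in `H^t`, with
  -- a sequence in `H^{-t}`.
  have h2 : Summable ((fun p : Freq n × Freq n => a p.1 * b p.2 * ψ (p.1 + p.2)) ∘ e) := by
    refine summable_of_tsum_enorm_ne_top ?_
    rw [ENNReal.tsum_prod']
    refine ne_of_eq_of_ne (tsum_congr fun ζ => ?_) h1
    unfold absConv
    rw [← ENNReal.tsum_mul_right]
    refine tsum_congr fun ξ => ?_
    simp [e, moduli, enorm_mul]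
  refine (h2.hasSum_iff).2 ?_
  rw [h2.tsum_prod]
  refine tsum_congr fun ζ => ?_
  unfold conv
  rw [← tsum_mul_right]
  exact tsum_congr fun ξ => by simp [e]

/-- Products of balls exhaust all frequency pairs, so an unconditional sum is the limit of its
truncations; this links `HasSum` to `IsAdvection`. -/
theorem tendsto_freqBall_prod :
    Filter.Tendsto (fun m => freqBall n m ×ˢ freqBall n m) Filter.atTop Filter.atTop := by
  refine Filter.tendsto_atTop_finset_of_monotone ?_ ?_
  · intro m m' h
    have h1 : freqBall n m ⊆ freqBall n m' := by
      intro ξ hξ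
      have h2 : (m : ℤ) ≤ m' := by exact_mod_cast h
      simp only [freqBall, Finset.mem_filter, Fintype.mem_piFinset, Finset.mem_Icc] at hξ ⊢
      refine ⟨fun j => ⟨by linarith [(hξ.1 j).1], by linarith [(hξ.1 j).2]⟩, hξ.2.trans ?_⟩
      gcongr
    exact Finset.product_subset_product h1 h1
  · have h1 : ∀ ξ : Freq n, ∃ m₀ : ℕ, ∀ m ≥ m₀, ξ ∈ freqBall n m := by
      intro ξ
      have h3 : ∀ j, ξ j ^ 2 ≤ ∑ j, ξ j ^ 2 := fun j =>
        Finset.single_le_sum (f := fun j => ξ j ^ 2) (fun i _ => sq_nonneg _) (Finset.mem_univ j)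
      have h0 : 0 ≤ ∑ j, ξ j ^ 2 := Finset.sum_nonneg fun i _ => sq_nonneg _
      -- Taking `m ≥ |ξ|²` avoids a square root: integers satisfy `|ξⱼ| ≤ ξⱼ²` and `m ≤ m²`.
      refine ⟨(∑ j, ξ j ^ 2).toNat, fun m hm => ?_⟩
      have h2 : ∑ j, ξ j ^ 2 ≤ (m : ℤ) := by omega
      simp only [freqBall, Finset.mem_filter, Fintype.mem_piFinset, Finset.mem_Icc]
      have h4 : (m : ℤ) ≤ (m : ℤ) ^ 2 := by
        rcases Nat.eq_zero_or_pos m with h | h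
        · simp [h]
        · have : (1 : ℤ) ≤ m := by exact_mod_cast h
          nlinarith
      refine ⟨fun j => abs_le.1 ?_, h2.trans h4⟩
      have h5 := Int.le_self_sq |ξ j|
      rw [sq_abs] at h5
      linarith [h3 j]
    rintro ⟨ξ, η⟩
    obtain ⟨m₁, h1'⟩ := h1 ξ
    obtain ⟨m₂, h2'⟩ := h1 η
    exact ⟨max m₁ m₂, Finset.mem_product.2 ⟨h1' _ (le_max_left _ _), h2' _ (le_max_right _ _)⟩⟩

/-! ### Integration over the torus and Fourier coefficients of test functions -/

theorem setIntegral_cube (F : EuclideanSpace ℝ (Fin n) → ℂ) :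
    ∫ x in cube n, F x = ∫ y in Set.Icc (0 : Fin n → ℝ) 1, F (WithLp.toLp 2 y) := by
  rw [← (PiLp.volume_preserving_toLp (Fin n)).setIntegral_preimage_emb
    (MeasurableEquiv.toLp 2 (Fin n → ℝ)).measurableEmbedding F]
  have h : WithLp.toLp 2 ⁻¹' cube n = Set.univ.pi fun _ : Fin n => Set.Ico (0 : ℝ) 1 := by
    ext y
    simp [cube]
  rw [h]
  exact setIntegral_congr_set Measure.univ_pi_Ico_ae_eq_Icc

theorem volume_cube : volume (cube n) = 1 := by
  rw [← (PiLp.volume_preserving_toLp (Fin n)).measure_preimage_emb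
    (MeasurableEquiv.toLp 2 (Fin n → ℝ)).measurableEmbedding]
  have h : WithLp.toLp 2 ⁻¹' cube n = Set.univ.pi fun _ : Fin n => Set.Ico (0 : ℝ) 1 := by
    ext y
    simp [cube]
  rw [h, Real.volume_pi_Ico]
  simp

/-- The divergence theorem for the field whose only nonzero component is `φ`, in place `j`; opposite
faces cancel by periodicity. -/
theorem integral_cube_pderiv (φ : PeriodicSmooth n) (j : Fin n) :
    ∫ x in cube n, (pderiv j φ).1 x = 0 := by
  cases n with
  | zero => exact j.elim0
  | succ m =>
  rw [setIntegral_cube]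
  let L : (Fin (m + 1) → ℝ) →L[ℝ] EuclideanSpace ℝ (Fin (m + 1)) :=
    (PiLp.continuousLinearEquiv 2 ℝ (fun _ : Fin (m + 1) => ℝ)).symm
  have hL : ∀ y, L y = WithLp.toLp 2 y := fun _ => rfl
  have hd : Differentiable ℝ φ.1 := φ.2.1.differentiable (by simp)
  let f : Fin (m + 1) → (Fin (m + 1) → ℝ) → ℂ := fun i y => if i = j then φ.1 (L y) else 0
  let f' : Fin (m + 1) → (Fin (m + 1) → ℝ) → (Fin (m + 1) → ℝ) →L[ℝ] ℂ := fun i y =>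
    if i = j then (fderiv ℝ φ.1 (L y)).comp L else 0
  have hf : ∀ y i, HasFDerivAt (f i) (f' i y) y := by
    intro y i
    by_cases h : i = j
    · simp only [f, f', if_pos h]
      exact (hd (L y)).hasFDerivAt.comp y L.hasFDerivAt
    · simp only [f, f', if_neg h]
      exact hasFDerivAt_const _ _
  have hsum : ∀ y, ∑ i, f' i y (Pi.single i 1) = (pderiv j φ).1 (WithLp.toLp 2 y) := by
    intro y
    rw [Finset.sum_eq_single j (fun i _ h => by simp [f', h]) (by simp)]
    simp only [f', if_true]
    rfl
  have hcont : Continuous fun y : Fin (m + 1) → ℝ => (pderiv j φ).1 (WithLp.toLp 2 y) :=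
    (pderiv j φ).2.1.continuous.comp L.continuous
  have key := integral_divergence_of_hasFDerivAt_off_countable' (0 : Fin (m + 1) → ℝ) 1
    zero_le_one f f' ∅ Set.countable_empty
    (fun i => (continuous_iff_continuousAt.2 fun y => (hf y i).continuousAt).continuousOn)
    (fun y _ i => hf y i)
    (by simp only [hsum]; exact hcont.continuousOn.integrableOn_compact isCompact_Icc)
  simp only [hsum] at key
  rw [key]
  refine Finset.sum_eq_zero fun i _ => ?_
  rw [sub_eq_zero]
  refine integral_congr_ae (Filter.Eventually.of_forall fun y => ?_)
  by_cases h : i = j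
  · simp only [f, if_pos h, hL]
    refine Eq.trans ?_ (φ.2.2 (Pi.single i 1) _)
    refine congrArg φ.1 (PiLp.ext fun k => ?_)
    refine Fin.succAboveCases i ?_ (fun k => ?_) k
    · simp [latticePt]
    · simp [latticePt]
  · simp [f, h]

/-- The product of smooth periodic functions. -/
def pmul (φ ψ : PeriodicSmooth n) : PeriodicSmooth n :=
  ⟨fun x => φ.1 x * ψ.1 x, φ.2.1.mul ψ.2.1, fun ξ x => congrArg₂ _ (φ.2.2 ξ x) (ψ.2.2 ξ x)⟩

theorem pderiv_pmul (j : Fin n) (φ ψ : PeriodicSmooth n) (x : EuclideanSpace ℝ (Fin n)) :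
    (pderiv j (pmul φ ψ)).1 x = φ.1 x * (pderiv j ψ).1 x + (pderiv j φ).1 x * ψ.1 x := by
  have h1 := (φ.2.1.differentiable (by simp)) x
  have h2 := (ψ.2.1.differentiable (by simp)) x
  change fderiv ℝ (fun x => φ.1 x * ψ.1 x) x _ = _
  rw [fderiv_fun_mul h1 h2]
  simp [pderiv, mul_comm]

theorem char_apply (ξ : Freq n) (x : EuclideanSpace ℝ (Fin n)) : (char ξ).1 x =
    Complex.exp (2 * Real.pi * Complex.I * ((∑ j, x j * (ξ j : ℝ) : ℝ) : ℂ)) := rfl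

theorem char_mul_char (ξ η : Freq n) (x : EuclideanSpace ℝ (Fin n)) :
    (char ξ).1 x * (char η).1 x = (char (ξ + η)).1 x := by
  simp only [char_apply]
  rw [← Complex.exp_add, ← mul_add]
  congr 2
  norm_cast
  rw [← Finset.sum_add_distrib]
  refine Finset.sum_congr rfl fun j _ => ?_
  simp only [Pi.add_apply]
  push_cast
  ring

theorem norm_char (ξ : Freq n) (x : EuclideanSpace ℝ (Fin n)) : ‖(char ξ).1 x‖ = 1 := by
  rw [char_apply, Complex.norm_exp]
  simp

theorem pderiv_char (j : Fin n) (ξ : Freq n) :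
    pderiv j (char ξ) = (2 * Real.pi * Complex.I * (ξ j : ℂ)) • char ξ := by
  ext x
  let L : EuclideanSpace ℝ (Fin n) →L[ℝ] ℝ :=
    ∑ j, (ξ j : ℝ) • (EuclideanSpace.proj j : EuclideanSpace ℝ (Fin n) →L[ℝ] ℝ)
  have hL : ∀ x, L x = ∑ j, x j * (ξ j : ℝ) := fun x => by simp [L, mul_comm]
  have h1 : HasFDerivAt (char ξ).1 _ x :=
    (((Complex.ofRealCLM.comp L).hasFDerivAt (x := x)).const_mul
      (2 * Real.pi * Complex.I)).cexp.congr_of_eventuallyEq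
      (Filter.Eventually.of_forall fun y => by simp [char_apply, hL])
  change fderiv ℝ (char ξ).1 x _ = _
  rw [h1.fderiv]
  have h2 : L (EuclideanSpace.single j 1) = ξ j := by
    simp [hL]
  simp only [smul_apply, ContinuousLinearMap.comp_apply, h2]
  change _ = _ * (char ξ).1 x
  rw [char_apply, ← hL]
  simp
  ring

theorem integrableOn_cube (φ : PeriodicSmooth n) : IntegrableOn φ.1 (cube n) := by
  have h : cube n ⊆ WithLp.toLp 2 '' Set.Icc (0 : Fin n → ℝ) 1 := by
    intro x hx
    exact ⟨WithLp.ofLp x, ⟨fun i => (hx i).1, fun i => (hx i).2.le⟩, rfl⟩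
  have hc : IsCompact ((WithLp.toLp 2 : (Fin n → ℝ) → EuclideanSpace ℝ (Fin n)) ''
      Set.Icc (0 : Fin n → ℝ) 1) :=
    isCompact_Icc.image (PiLp.continuous_toLp 2 _)
  exact (φ.2.1.continuous.continuousOn.integrableOn_compact hc).mono_set h

/-- The Fourier coefficient of a smooth periodic function at the frequency `-ζ`. -/
def testCoef (φ : PeriodicSmooth n) (ζ : Freq n) : ℂ := ∫ x in cube n, (char ζ).1 x * φ.1 x

theorem testCoef_add (φ ψ : PeriodicSmooth n) (ζ : Freq n) :
    testCoef (φ + ψ) ζ = testCoef φ ζ + testCoef ψ ζ := by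
  refine Eq.trans ?_
    (integral_add (integrableOn_cube (pmul (char ζ) φ)) (integrableOn_cube (pmul (char ζ) ψ)))
  exact integral_congr_ae (Filter.Eventually.of_forall fun x => mul_add _ _ _)

theorem testCoef_smul (c : ℂ) (φ : PeriodicSmooth n) (ζ : Freq n) :
    testCoef (c • φ) ζ = c * testCoef φ ζ := by
  unfold testCoef
  rw [← integral_const_mul]
  exact integral_congr_ae (Filter.Eventually.of_forall fun x => mul_left_comm _ c _)

theorem testCoef_pderiv (j : Fin n) (φ : PeriodicSmooth n) (ζ : Freq n) :
    testCoef (pderiv j φ) ζ = -(2 * Real.pi * Complex.I * (ζ j : ℂ)) * testCoef φ ζ := by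
  have h := integral_cube_pderiv (pmul (char ζ) φ) j
  simp only [pderiv_pmul] at h
  have h0 := (integral_add (integrableOn_cube (pmul (char ζ) (pderiv j φ)))
    (integrableOn_cube (pmul (pderiv j (char ζ)) φ))).symm.trans h
  have h1 : ∫ x in cube n, (pderiv j (char ζ)).1 x * φ.1 x =
      (2 * Real.pi * Complex.I * (ζ j : ℂ)) * testCoef φ ζ := by
    unfold testCoef
    rw [← integral_const_mul, pderiv_char]
    exact integral_congr_ae (Filter.Eventually.of_forall fun x => mul_assoc _ _ _)
  change testCoef (pderiv j φ) ζ + ∫ x in cube n, (pderiv j (char ζ)).1 x * φ.1 x = 0 at h0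
  rw [h1] at h0
  linear_combination h0

theorem integral_char (ξ : Freq n) : ∫ x in cube n, (char ξ).1 x = if ξ = 0 then 1 else 0 := by
  split_ifs with h
  · subst h
    have : ∀ x, (char (0 : Freq n)).1 x = 1 := fun x => by simp [char_apply]
    simp [this, Measure.real, volume_cube]
  · obtain ⟨j, hj⟩ := Function.ne_iff.1 h
    have h1 := integral_cube_pderiv (char ξ) j
    rw [pderiv_char] at h1
    have h2 : ∫ x in cube n, ((2 * Real.pi * Complex.I * (ξ j : ℂ)) • char ξ).1 x =
      (2 * Real.pi * Complex.I * (ξ j : ℂ)) * ∫ x in cube n, (char ξ).1 x :=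
      integral_const_mul _ _
    rw [h2, mul_eq_zero] at h1
    refine h1.resolve_left ?_
    have : (ξ j : ℂ) ≠ 0 := by exact_mod_cast hj
    simp [this, Real.pi_ne_zero]

theorem testCoef_char (ξ ζ : Freq n) : testCoef (char ξ) ζ = if ζ = -ξ then 1 else 0 := by
  unfold testCoef
  simp only [char_mul_char, integral_char, add_eq_zero_iff_eq_neg]

theorem norm_testCoef_le {φ : PeriodicSmooth n} {M : ℝ} (h : ∀ x, ‖φ.1 x‖ ≤ M) (ζ : Freq n) :
    ‖testCoef φ ζ‖ ≤ M := by
  have h1 := norm_setIntegral_le_of_norm_le_const (μ := volume) (s := cube n)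
    (f := fun x => (char ζ).1 x * φ.1 x) (C := M) (by simp [volume_cube])
    (fun x _ => by rw [norm_mul, norm_char, one_mul]; exact h x)
  simpa [Measure.real, volume_cube, testCoef] using h1

theorem norm_iteratedFDeriv_pderiv_le (j : Fin n) (φ : PeriodicSmooth n) (k : ℕ)
    (x : EuclideanSpace ℝ (Fin n)) :
    ‖iteratedFDeriv ℝ k (pderiv j φ).1 x‖ ≤ ‖iteratedFDeriv ℝ (k + 1) φ.1 x‖ := by
  have h1 : ContDiff ℝ k (fderiv ℝ φ.1) := φ.2.1.fderiv_right (by exact_mod_cast le_top)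
  have h2 := norm_iteratedFDeriv_clm_apply_const (𝕜 := ℝ)
    (c := (EuclideanSpace.single j 1 : EuclideanSpace ℝ (Fin n))) (n := k)
    (h1.contDiffAt (x := x)) le_rfl
  rw [norm_iteratedFDeriv_fderiv, PiLp.norm_single, norm_one, one_mul] at h2
  exact h2

/-- Integration by parts `K` times in direction `j`; each one yields a factor `2π|ζⱼ| ≥ |ζⱼ|`. -/
theorem abs_pow_mul_norm_testCoef_le (j : Fin n) (ζ : Freq n) (K : ℕ) :
    ∀ (φ : PeriodicSmooth n) (M : ℝ), (∀ k ≤ K, ∀ x, ‖iteratedFDeriv ℝ k φ.1 x‖ ≤ M) →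
      |(ζ j : ℝ)| ^ K * ‖testCoef φ ζ‖ ≤ M := by
  induction K with
  | zero =>
    intro φ M h
    simpa using norm_testCoef_le (fun x => by simpa using h 0 le_rfl x) ζ
  | succ K ih =>
    intro φ M h
    have h1 := ih (pderiv j φ) M fun k hk x =>
      (norm_iteratedFDeriv_pderiv_le j φ k x).trans (h (k + 1) (by omega) x)
    rw [testCoef_pderiv] at h1
    refine le_trans ?_ h1
    have h2 : |(ζ j : ℝ)| ≤ ‖-(2 * Real.pi * Complex.I * (ζ j : ℂ))‖ := by
      have h3 : ‖(ζ j : ℂ)‖ = |(ζ j : ℝ)| := by simp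
      rw [norm_neg, norm_mul, h3]
      have : 1 ≤ ‖2 * (Real.pi : ℂ) * Complex.I‖ := by
        simp [abs_of_pos Real.pi_pos]
        linarith [Real.pi_gt_three]
      nlinarith [abs_nonneg (ζ j : ℝ)]
    rw [pow_succ, norm_mul, mul_assoc]
    gcongr

theorem rho_le_of_forall {ζ : Freq n} {A : ℝ} (hA : 1 ≤ A) (h : ∀ j, |(ζ j : ℝ)| ≤ A) :
    rho ζ ≤ (n + 1) * A := by
  unfold rho
  refine Real.sqrt_le_iff.2 ⟨by positivity, ?_⟩
  have h1 : ∑ j, (ζ j : ℝ) ^ 2 ≤ ∑ _j : Fin n, A ^ 2 :=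
    Finset.sum_le_sum fun j _ => sq_le_sq' (abs_le.1 (h j)).1 (abs_le.1 (h j)).2
  rw [Finset.sum_const, Finset.card_univ, Fintype.card_fin, nsmul_eq_mul] at h1
  have : (0 : ℝ) ≤ n := Nat.cast_nonneg n
  nlinarith [mul_nonneg this (sq_nonneg A), mul_nonneg (mul_nonneg this this) (sq_nonneg A)]

/-- Integrate by parts along the largest coordinate, which controls `ρ(ζ)`. The bound is explicit in
`M` because continuity of the functionals in `ofCoef` requires it. -/
theorem rho_pow_mul_norm_testCoef_le (K : ℕ) (φ : PeriodicSmooth n) (M : ℝ)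
    (h : ∀ k ≤ K, ∀ x, ‖iteratedFDeriv ℝ k φ.1 x‖ ≤ M) (ζ : Freq n) :
    rho ζ ^ K * ‖testCoef φ ζ‖ ≤ (n + 1) ^ K * M := by
  have h0 : ‖testCoef φ ζ‖ ≤ M := norm_testCoef_le (fun x => by simpa using h 0 (Nat.zero_le _) x) ζ
  have hr := (rho_pos ζ).le
  by_cases hz : ∀ j, |(ζ j : ℝ)| ≤ 1
  · have h1 := rho_le_of_forall le_rfl hz
    rw [mul_one] at h1
    gcongr
  · push Not at hz
    obtain ⟨i, hi⟩ := hz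
    obtain ⟨j, -, hj⟩ := Finset.exists_max_image Finset.univ (fun j => |(ζ j : ℝ)|)
      ⟨i, Finset.mem_univ i⟩
    have h1 := rho_le_of_forall (hi.le.trans (hj i (Finset.mem_univ i)))
      fun k => hj k (Finset.mem_univ k)
    calc _ ≤ ((n + 1) * |(ζ j : ℝ)|) ^ K * ‖testCoef φ ζ‖ := by gcongr
      _ = (n + 1) ^ K * (|(ζ j : ℝ)| ^ K * ‖testCoef φ ζ‖) := by rw [mul_pow]; ring
      _ ≤ _ := by
        gcongr
        exact abs_pow_mul_norm_testCoef_le j ζ K φ M h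

theorem exists_iteratedFDeriv_bound (φ : PeriodicSmooth n) (k : ℕ) :
    ∃ M, ∀ x, ‖iteratedFDeriv ℝ k φ.1 x‖ ≤ M := by
  have hper : ∀ (ξ : Freq n) x,
      iteratedFDeriv ℝ k φ.1 (x + latticePt ξ) = iteratedFDeriv ℝ k φ.1 x := by
    intro ξ x
    rw [← iteratedFDeriv_comp_add_right]
    exact congrArg (fun f => iteratedFDeriv ℝ k f x) (funext (φ.2.2 ξ))
  have hc : IsCompact ((WithLp.toLp 2 : (Fin n → ℝ) → EuclideanSpace ℝ (Fin n)) ''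
      Set.Icc (0 : Fin n → ℝ) 1) :=
    isCompact_Icc.image (PiLp.continuous_toLp 2 _)
  obtain ⟨M, hM⟩ := hc.exists_bound_of_continuousOn
    (φ.2.1.continuous_iteratedFDeriv (m := k) (by exact_mod_cast le_top)).continuousOn
  refine ⟨M, fun x => ?_⟩
  -- Translating by the integer parts moves `x` into the compact unit cube.
  rw [← hper (fun i => -⌊x i⌋)]
  refine hM _ ⟨fun i => Int.fract (x i), ⟨fun i => Int.fract_nonneg _,
    fun i => (Int.fract_lt_one _).le⟩, PiLp.ext fun i => ?_⟩
  simp [latticePt, Int.fract, sub_eq_add_neg]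

theorem exists_rho_pow_mul_norm_testCoef_le (K : ℕ) (φ : PeriodicSmooth n) :
    ∃ M, ∀ ζ, rho ζ ^ K * ‖testCoef φ ζ‖ ≤ M := by
  choose M hM using exists_iteratedFDeriv_bound φ
  refine ⟨_, rho_pow_mul_norm_testCoef_le K φ (∑ k ∈ Finset.range (K + 1), |M k|)
    fun k hk x => (hM k x).trans ((le_abs_self _).trans ?_)⟩
  exact Finset.single_le_sum (f := fun k => |M k|) (fun i _ => abs_nonneg _)
    (Finset.mem_range.2 (by omega))

/-! ### Distributions with prescribed Fourier coefficients -/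

/-- The sequences `c` such that `∑ |c(ζ)| ρ(ζ)^p` is finite for some `p`. -/
def PolyGrowth (n : ℕ) : Submodule ℂ (Freq n → ℂ) where
  carrier := {c | ∃ K : ℕ, Summable fun ζ => ‖c ζ‖ * (rho ζ ^ K)⁻¹}
  add_mem' := by
    rintro a b ⟨K, ha⟩ ⟨L, hb⟩
    refine ⟨K + L, Summable.of_nonneg_of_le (fun ζ => ?_) (fun ζ => ?_) (ha.add hb)⟩
    · have := rho_pos ζ
      positivity
    · have h0 := rho_pos ζ
      have h1 := one_le_rho ζ
      have hK : (rho ζ ^ (K + L))⁻¹ ≤ (rho ζ ^ K)⁻¹ :=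
        inv_anti₀ (by positivity) (pow_le_pow_right₀ h1 (by omega))
      have hL : (rho ζ ^ (K + L))⁻¹ ≤ (rho ζ ^ L)⁻¹ :=
        inv_anti₀ (by positivity) (pow_le_pow_right₀ h1 (by omega))
      calc _ ≤ (‖a ζ‖ + ‖b ζ‖) * (rho ζ ^ (K + L))⁻¹ := by
            gcongr
            exact norm_add_le _ _
        _ ≤ _ := by
          rw [add_mul]
          gcongr
  zero_mem' := ⟨0, by simp⟩
  smul_mem' := by
    rintro c a ⟨K, ha⟩
    refine ⟨K, (ha.mul_left ‖c‖).congr fun ζ => ?_⟩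
    simp [mul_assoc]

theorem norm_mul_testCoef_le {K : ℕ} {φ : PeriodicSmooth n} {M : ℝ}
    (hM : ∀ ζ, rho ζ ^ K * ‖testCoef φ ζ‖ ≤ M) (c : Freq n → ℂ) (ζ : Freq n) :
    ‖c ζ * testCoef φ ζ‖ ≤ ‖c ζ‖ * (rho ζ ^ K)⁻¹ * M := by
  have h0 := rho_pos ζ
  rw [norm_mul, mul_assoc]
  gcongr
  rw [← div_eq_inv_mul, le_div_iff₀ (by positivity), mul_comm]
  exact hM ζ

theorem summable_mul_testCoef (c : PolyGrowth n) (φ : PeriodicSmooth n) :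
    Summable fun ζ => c.1 ζ * testCoef φ ζ := by
  obtain ⟨K, hK⟩ := c.2
  obtain ⟨M, hM⟩ := exists_rho_pow_mul_norm_testCoef_le K φ
  exact Summable.of_norm_bounded (hK.mul_right M) (norm_mul_testCoef_le hM c.1)

/-- The distribution with Fourier coefficients `c`. -/
def ofCoef (n : ℕ) : PolyGrowth n →ₗ[ℂ] Dist n where
  toFun c := ⟨
    { toFun := fun φ => ∑' ζ, c.1 ζ * testCoef φ ζ
      map_add' := fun φ ψ => by
        rw [← (summable_mul_testCoef c φ).tsum_add (summable_mul_testCoef c ψ)]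
        exact tsum_congr fun ζ => by rw [testCoef_add]; ring
      map_smul' := fun a φ => by
        rw [RingHom.id_apply, smul_eq_mul, ← tsum_mul_left]
        exact tsum_congr fun ζ => by rw [testCoef_smul]; ring }, by
    obtain ⟨K, hK⟩ := c.2
    refine ⟨(∑' ζ, ‖c.1 ζ‖ * (rho ζ ^ K)⁻¹) * (n + 1) ^ K, K, fun φ M h => ?_⟩
    have h1 := norm_mul_testCoef_le (rho_pow_mul_norm_testCoef_le K φ M h) c.1
    refine (tsum_of_norm_bounded (hK.mul_right _).hasSum h1).trans (le_of_eq ?_)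
    rw [tsum_mul_right, mul_assoc]⟩
  map_add' a b := Subtype.ext <| LinearMap.ext fun φ => by
    refine Eq.trans ?_ ((summable_mul_testCoef a φ).tsum_add (summable_mul_testCoef b φ))
    exact tsum_congr fun ζ => add_mul _ _ _
  map_smul' a b := Subtype.ext <| LinearMap.ext fun φ => by
    refine Eq.trans ?_ (tsum_mul_left (a := a))
    exact tsum_congr fun ζ => mul_assoc _ _ _

theorem ofCoef_apply (c : PolyGrowth n) (φ : PeriodicSmooth n) :
    (ofCoef n c).1 φ = ∑' ζ, c.1 ζ * testCoef φ ζ := rfl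

theorem fourierCoef_ofCoef (c : PolyGrowth n) (ξ : Freq n) : fourierCoef (ofCoef n c) ξ = c.1 ξ := by
  unfold fourierCoef
  rw [ofCoef_apply]
  simp only [testCoef_char, neg_neg]
  rw [tsum_eq_single ξ (fun ζ h => by simp [h])]
  simp

theorem mem_polyGrowth_of_sobSq {t : ℝ} {c : Freq n → ℂ} (h : sobSq t (moduli c) ≠ ⊤) :
    c ∈ PolyGrowth n := by
  -- With `K > n/2 - t` the series `∑ ρ^{-2K-2t}` converges, and `‖c‖ρ^{-K}` is the product of
  -- `ρ^t‖c‖` and `ρ^{-K-t}`, both square summable.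
  obtain ⟨K, hK⟩ := exists_nat_gt ((n - 2 * t) / 2)
  refine ⟨K, ?_⟩
  have h1 := (ENNReal.summable_toReal h).congr (g := fun ζ => rho ζ ^ (2 * t) * ‖c ζ‖ ^ 2)
    fun ζ => by
      simp [moduli, ENNReal.toReal_mul, ENNReal.toReal_ofReal (Real.rpow_nonneg (rho_pos ζ).le _)]
  have h2 := summable_rho_rpow (n := n) (α := 2 * (-K - t)) (by linarith)
  refine Summable.of_nonneg_of_le (fun ζ => ?_) (fun ζ => ?_) (h1.add h2)
  · have := rho_pos ζ
    positivity
  · have h0 := rho_pos ζ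
    have e1 : rho ζ ^ (2 * t) = (rho ζ ^ t) ^ 2 := by
      rw [mul_comm, Real.rpow_mul h0.le, Real.rpow_two]
    have e2 : rho ζ ^ (2 * (-K - t)) = ((rho ζ ^ K)⁻¹ * (rho ζ ^ t)⁻¹) ^ 2 := by
      rw [mul_comm, Real.rpow_mul h0.le, Real.rpow_two, sub_eq_add_neg, Real.rpow_add h0,
        Real.rpow_neg h0.le, Real.rpow_neg h0.le, Real.rpow_natCast]
    rw [e1, e2]
    have h4 : 0 < rho ζ ^ t := by positivity
    have e3 : ‖c ζ‖ * (rho ζ ^ K)⁻¹ =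
        (rho ζ ^ t * ‖c ζ‖) * ((rho ζ ^ K)⁻¹ * (rho ζ ^ t)⁻¹) := by
      field_simp
    rw [e3]
    nlinarith [sq_nonneg (rho ζ ^ t * ‖c ζ‖ - (rho ζ ^ K)⁻¹ * (rho ζ ^ t)⁻¹),
      sq_nonneg (rho ζ ^ t * ‖c ζ‖), sq_nonneg ((rho ζ ^ K)⁻¹ * (rho ζ ^ t)⁻¹)]

theorem sobSq_testCoef_ne_top (t : ℝ) (φ : PeriodicSmooth n) :
    sobSq t (moduli (testCoef φ)) ≠ ⊤ := by
  obtain ⟨K, hK⟩ := exists_nat_gt ((n + 2 * t) / 2)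
  obtain ⟨M, hM⟩ := exists_rho_pow_mul_norm_testCoef_le K φ
  obtain ⟨C, -, hC⟩ := exists_tsum_rho_rpow_le (n := n) (α := 2 * t - 2 * K) (by linarith)
  refine ne_top_of_le_ne_top (b := ENNReal.ofReal (M ^ 2) * ENNReal.ofReal C) (by finiteness) ?_
  refine le_trans ?_ (mul_le_mul_right hC _)
  rw [← ENNReal.tsum_mul_left]
  refine ENNReal.tsum_le_tsum fun ζ => ?_
  have h0 := rho_pos ζ
  rw [moduli, ← ofReal_norm, ← ENNReal.ofReal_pow (norm_nonneg _),
    ← ENNReal.ofReal_mul (by positivity), ← ENNReal.ofReal_mul (by positivity)]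
  refine ENNReal.ofReal_le_ofReal ?_
  have h1 : (rho ζ ^ K * ‖testCoef φ ζ‖) ^ 2 ≤ M ^ 2 := by
    have := hM ζ
    gcongr
  have e : rho ζ ^ (2 * t) = rho ζ ^ (2 * t - 2 * K) * (rho ζ ^ K) ^ 2 := by
    rw [← pow_mul, ← Real.rpow_natCast, ← Real.rpow_add h0]
    push_cast
    ring_nf
  calc _ = (rho ζ ^ K * ‖testCoef φ ζ‖) ^ 2 * rho ζ ^ (2 * t - 2 * K) := by rw [e]; ring
    _ ≤ _ := by gcongr

/-! ### Real Sobolev norms and their extended nonnegative counterparts -/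

theorem mem_sobolev_iff {s : ℝ} {g : Dist n} :
    g ∈ Sobolev n s ↔ sobSq s (moduli (fourierCoef g)) ≠ ⊤ := by
  have h1 : ∀ ξ : Freq n, ENNReal.ofReal (rho ξ ^ (2 * s)) * moduli (fourierCoef g) ξ ^ 2 =
      ENNReal.ofReal (rho ξ ^ (2 * s) * ‖fourierCoef g ξ‖ ^ 2) := fun ξ => by
    have := rho_pos ξ
    rw [ENNReal.ofReal_mul (by positivity), ENNReal.ofReal_pow (norm_nonneg _), ofReal_norm]
    rfl
  have h0 : ∀ ξ : Freq n, 0 ≤ rho ξ ^ (2 * s) * ‖fourierCoef g ξ‖ ^ 2 := fun ξ => by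
    have := rho_pos ξ
    positivity
  unfold sobSq
  simp only [h1]
  constructor
  · intro h
    rw [← ENNReal.ofReal_tsum_of_nonneg h0 h]
    exact ENNReal.ofReal_ne_top
  · intro h
    exact (ENNReal.summable_toReal h).congr fun ξ => ENNReal.toReal_ofReal (h0 ξ)

theorem mem_sobolevVec_iff {s : ℝ} {w : Fin n → Dist n} :
    w ∈ SobolevVec n s ↔ ∀ k, sobSq s (moduli (fourierCoef (w k))) ≠ ⊤ := by
  simp [SobolevVec, Submodule.mem_pi, mem_sobolev_iff]

/-- The squared norm of `(H^s)ⁿ`, with value `∞` outside this space. -/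
def vecSq (s : ℝ) (w : Fin n → Dist n) : ℝ≥0∞ := ∑ k, sobSq s (moduli (fourierCoef (w k)))

/-- Membership matters: a divergent real series has the default value `0`, whereas `vecSq` is then
infinite. -/
theorem ofReal_sobolevNorm_sq {s : ℝ} {w : Fin n → Dist n} (hw : w ∈ SobolevVec n s) :
    ENNReal.ofReal (sobolevNorm s w ^ 2) = vecSq s w := by
  have h0 : ∀ k (ξ : Freq n), 0 ≤ rho ξ ^ (2 * s) * ‖fourierCoef (w k) ξ‖ ^ 2 := fun k ξ => by
    have := rho_pos ξ
    positivity
  rw [sobolevNorm, Real.sq_sqrt (Finset.sum_nonneg fun k _ => tsum_nonneg (h0 k)),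
    ENNReal.ofReal_sum_of_nonneg fun k _ => tsum_nonneg (h0 k)]
  refine Finset.sum_congr rfl fun k _ => ?_
  have hk : Summable fun ξ : Freq n => rho ξ ^ (2 * s) * ‖fourierCoef (w k) ξ‖ ^ 2 :=
    (Submodule.mem_pi.1 hw) k (Set.mem_univ k)
  rw [ENNReal.ofReal_tsum_of_nonneg (h0 k) hk]
  refine tsum_congr fun ξ => ?_
  have := rho_pos ξ
  rw [ENNReal.ofReal_mul (by positivity), ENNReal.ofReal_pow (norm_nonneg _), ofReal_norm]
  rfl

theorem sobolevNorm_nonneg (s : ℝ) (w : Fin n → Dist n) : 0 ≤ sobolevNorm s w := Real.sqrt_nonneg _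

/-- A triangle inequality with a lossy constant, which suffices for continuity. -/
theorem vecSq_add_le (s : ℝ) (u v : Fin n → Dist n) :
    vecSq s (u + v) ≤ 2 * (vecSq s u + vecSq s v) := by
  unfold vecSq
  rw [← Finset.sum_add_distrib, Finset.mul_sum]
  refine Finset.sum_le_sum fun k _ => ?_
  unfold sobSq
  rw [← ENNReal.tsum_add, ← ENNReal.tsum_mul_left]
  refine ENNReal.tsum_le_tsum fun ξ => ?_
  rw [← mul_add, mul_left_comm]
  gcongr
  refine le_trans ?_ (sq_add_le _ _)
  gcongr
  exact enorm_add_le _ _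

theorem sobolevNorm_add_sq_le {s : ℝ} {u v : Fin n → Dist n} (hu : u ∈ SobolevVec n s)
    (hv : v ∈ SobolevVec n s) :
    sobolevNorm s (u + v) ^ 2 ≤ 2 * (sobolevNorm s u ^ 2 + sobolevNorm s v ^ 2) := by
  have h := vecSq_add_le s u v
  rw [← ofReal_sobolevNorm_sq hu, ← ofReal_sobolevNorm_sq hv,
    ← ofReal_sobolevNorm_sq (add_mem hu hv), ← ENNReal.ofReal_add (by positivity) (by positivity),
    ← ENNReal.ofReal_ofNat, ← ENNReal.ofReal_mul (by positivity)] at h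
  exact (ENNReal.ofReal_le_ofReal_iff (by positivity)).1 h

theorem sobolevNorm_le_of_vecSq {s t : ℝ} {u v b : Fin n → Dist n} {C : ℝ≥0∞} (hC : C ≠ ⊤)
    (hu : u ∈ SobolevVec n s) (hv : v ∈ SobolevVec n s) (hb : b ∈ SobolevVec n t)
    (h : vecSq t b ≤ C * (vecSq s u * vecSq s v)) :
    sobolevNorm t b ≤ √C.toReal * (sobolevNorm s u * sobolevNorm s v) := by
  rw [← ofReal_sobolevNorm_sq hu, ← ofReal_sobolevNorm_sq hv, ← ofReal_sobolevNorm_sq hb,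
    ← ENNReal.ofReal_toReal hC, ← ENNReal.ofReal_mul (by positivity),
    ← ENNReal.ofReal_mul (by positivity), ENNReal.ofReal_le_ofReal_iff (by positivity)] at h
  have h1 := sobolevNorm_nonneg s u
  have h2 := sobolevNorm_nonneg s v
  refine abs_le_of_sq_le_sq' ?_ (by positivity) |>.2
  rw [mul_pow, Real.sq_sqrt ENNReal.toReal_nonneg, mul_pow]
  exact h

/-! ### Coefficient bounds for `div (u ⊗ v)` and `(w·∇)w` -/

theorem sobSq_deriv_le (t : ℝ) (j : Fin n) (c : Freq n → ℂ) :
    sobSq (t - 1) (moduli fun ζ => 2 * Real.pi * Complex.I * (ζ j : ℂ) * c ζ) ≤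
      ENNReal.ofReal (2 * Real.pi) ^ 2 * sobSq t (moduli c) := by
  rw [← rho_mul_sobSq t, ← sobSq_const_mul]
  refine sobSq_mono fun ζ => ?_
  rw [← mul_assoc, ← ENNReal.ofReal_mul (by positivity)]
  unfold moduli
  rw [enorm_mul]
  gcongr
  rw [← ofReal_norm]
  refine ENNReal.ofReal_le_ofReal ?_
  have h3 : ‖(ζ j : ℂ)‖ = |(ζ j : ℝ)| := by simp
  rw [norm_mul, h3]
  have h4 : ‖2 * (Real.pi : ℂ) * Complex.I‖ = 2 * Real.pi := by
    simp [abs_of_pos Real.pi_pos]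
  rw [h4]
  gcongr
  exact abs_coord_le_rho ζ j

theorem sobSq_moduli_sum_le (t : ℝ) (c : Fin n → Freq n → ℂ) :
    sobSq t (moduli fun ζ => ∑ j, c j ζ) ≤ n * ∑ j, sobSq t (moduli (c j)) := by
  refine (sobSq_mono fun ζ => ?_).trans ((sobSq_sum_le t fun j => moduli (c j)).trans_eq (by simp))
  exact enorm_sum_le _ _

/-- The Fourier coefficients of the `k`-th component of `div (u ⊗ v)`. -/
def divTensorCoef (u v : Fin n → Dist n) (k : Fin n) (ζ : Freq n) : ℂ :=
  ∑ j, 2 * Real.pi * Complex.I * (ζ j : ℂ) * conv (fourierCoef (u j)) (fourierCoef (v k)) ζ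

/-- The Fourier coefficients of the `k`-th component of `(w·∇)w`. -/
def advectionCoef (w : Fin n → Dist n) (k : Fin n) (ζ : Freq n) : ℂ :=
  ∑ j, conv (fourierCoef (w j))
    (fun η => 2 * Real.pi * Complex.I * (η j : ℂ) * fourierCoef (w k) η) ζ

theorem exists_divTensorCoef_bound {s t : ℝ} (h : ProductBound n s s t) :
    ∃ C : ℝ≥0∞, C ≠ ⊤ ∧ ∀ u v : Fin n → Dist n,
      ∑ k, sobSq (t - 1) (moduli (divTensorCoef u v k)) ≤ C * (vecSq s u * vecSq s v) := by
  obtain ⟨C, hC, hb⟩ := h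
  refine ⟨n * ENNReal.ofReal (2 * Real.pi) ^ 2 * C, by finiteness, fun u v => ?_⟩
  rw [vecSq, vecSq, Finset.sum_mul_sum, Finset.sum_comm, Finset.mul_sum]
  refine Finset.sum_le_sum fun k _ => ?_
  refine (sobSq_moduli_sum_le _ _).trans ?_
  have e : ∀ x : ℝ≥0∞, n * ENNReal.ofReal (2 * Real.pi) ^ 2 * C * x =
      n * (ENNReal.ofReal (2 * Real.pi) ^ 2 * (C * x)) := fun x => by ring
  rw [e]
  refine mul_le_mul' le_rfl ?_
  rw [Finset.mul_sum, Finset.mul_sum]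
  refine Finset.sum_le_sum fun j _ => ?_
  refine (sobSq_deriv_le _ _ _).trans (mul_le_mul_right ?_ _)
  exact (sobSq_mono (moduli_conv_le _ _)).trans (hb _ _)

theorem exists_advectionCoef_bound {s t : ℝ} (h : ProductBound n s (s - 1) t) :
    ∃ C : ℝ≥0∞, C ≠ ⊤ ∧ ∀ w : Fin n → Dist n,
      ∑ k, sobSq t (moduli (advectionCoef w k)) ≤ C * (vecSq s w * vecSq s w) := by
  obtain ⟨C, hC, hb⟩ := h
  refine ⟨n * (C * ENNReal.ofReal (2 * Real.pi) ^ 2), by finiteness, fun w => ?_⟩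
  rw [vecSq, Finset.sum_mul_sum, Finset.sum_comm, Finset.mul_sum]
  refine Finset.sum_le_sum fun k _ => ?_
  refine (sobSq_moduli_sum_le _ _).trans ?_
  have e : ∀ x : ℝ≥0∞, n * (C * ENNReal.ofReal (2 * Real.pi) ^ 2) * x =
      n * (C * ENNReal.ofReal (2 * Real.pi) ^ 2 * x) := fun x => by ring
  rw [e]
  refine mul_le_mul' le_rfl ?_
  rw [Finset.mul_sum]
  refine Finset.sum_le_sum fun j _ => ?_
  have h1 : ∀ x y z a : ℝ≥0∞, z ≤ a * y → C * (x * z) ≤ C * a * (x * y) := fun x y z a hz => by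
    calc C * (x * z) ≤ C * (x * (a * y)) := by gcongr
      _ = _ := by ring
  refine (sobSq_mono (moduli_conv_le _ _)).trans ((hb _ _).trans ?_)
  exact h1 _ _ _ _ (sobSq_deriv_le s j _)

/-! ### Identification of the distributional limit -/

theorem partialSum_apply (m : ℕ) (g : Dist n) (x : EuclideanSpace ℝ (Fin n)) :
    (partialSum m g).1 x = ∑ ξ ∈ freqBall n m, fourierCoef g ξ * (char ξ).1 x := by
  simp [partialSum, Finset.sum_apply]

theorem pderiv_partialSum_apply (j : Fin n) (m : ℕ) (g : Dist n) (x : EuclideanSpace ℝ (Fin n)) :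
    (pderiv j (partialSum m g)).1 x = ∑ ξ ∈ freqBall n m,
      2 * Real.pi * Complex.I * (ξ j : ℂ) * fourierCoef g ξ * (char ξ).1 x := by
  rw [partialSum, map_sum]
  simp only [map_smul, pderiv_char]
  rw [Submodule.coe_sum, Finset.sum_apply]
  refine Finset.sum_congr rfl fun ξ _ => ?_
  simp only [SetLike.val_smul, Pi.smul_apply, smul_eq_mul]
  ring

theorem integral_smoothAdvection (m : ℕ) (w : Fin n → Dist n) (k : Fin n) (φ : PeriodicSmooth n) :
    ∫ x in cube n, smoothAdvection (fun j => partialSum m (w j)) k x * φ.1 x =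
      ∑ p ∈ freqBall n m ×ˢ freqBall n m, ∑ j, fourierCoef (w j) p.1 *
        (2 * Real.pi * Complex.I * (p.2 j : ℂ) * fourierCoef (w k) p.2) *
          testCoef φ (p.1 + p.2) := by
  have h1 : ∀ x, smoothAdvection (fun j => partialSum m (w j)) k x * φ.1 x =
      ∑ p ∈ freqBall n m ×ˢ freqBall n m, ∑ j, fourierCoef (w j) p.1 *
        (2 * Real.pi * Complex.I * (p.2 j : ℂ) * fourierCoef (w k) p.2) *
          ((char (p.1 + p.2)).1 x * φ.1 x) := by
    intro x
    unfold smoothAdvection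
    rw [Finset.sum_comm, Finset.sum_mul]
    refine Finset.sum_congr rfl fun j _ => ?_
    rw [partialSum_apply, pderiv_partialSum_apply, Finset.sum_mul_sum, ← Finset.sum_product',
      Finset.sum_mul]
    refine Finset.sum_congr rfl fun p _ => ?_
    rw [← char_mul_char]
    ring
  simp only [h1]
  have hi : ∀ (p : Freq n × Freq n), Integrable (fun x => (char (p.1 + p.2)).1 x * φ.1 x)
      (volume.restrict (cube n)) := fun p => integrableOn_cube (pmul (char (p.1 + p.2)) φ)
  rw [integral_finsetSum _ fun p _ => integrable_finsetSum _ fun j _ => (hi p).const_mul _]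
  refine Finset.sum_congr rfl fun p _ => ?_
  rw [integral_finsetSum _ fun j _ => (hi p).const_mul _]
  exact Finset.sum_congr rfl fun j _ => integral_const_mul _ _

theorem div_apply_char (w : Fin n → Dist n) (ξ : Freq n) :
    fourierCoef (div w) ξ = ∑ j, 2 * Real.pi * Complex.I * (ξ j : ℂ) * fourierCoef (w j) ξ := by
  unfold div fourierCoef
  rw [Submodule.coe_sum, LinearMap.sum_apply]
  refine Finset.sum_congr rfl fun j _ => ?_
  simp [distDeriv, pderiv_char]

theorem sum_coord_mul_fourierCoef {w : Fin n → Dist n} (h : div w = 0) (ξ : Freq n) :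
    ∑ j, (ξ j : ℂ) * fourierCoef (w j) ξ = 0 := by
  have h1 := div_apply_char w ξ
  rw [h] at h1
  have h2 : fourierCoef (0 : Dist n) ξ = 0 := rfl
  simp only [h2, mul_assoc] at h1
  rw [← Finset.mul_sum, ← Finset.mul_sum, ← Finset.mul_sum] at h1
  simpa [Real.pi_ne_zero] using h1.symm

/-- The truncated integrals are the partial sums, over products of balls, of finitely many
absolutely convergent pairings of `w j ∈ H^s` with `∂ⱼ (w k) ∈ H^{s-1}`. -/
theorem isAdvection_of_advectionCoef {s t : ℝ} (h : ProductBound n s (s - 1) t)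
    {w b : Fin n → Dist n} (hw : w ∈ SobolevVec n s)
    (hb : ∀ k φ, (b k).1 φ = ∑' ζ, advectionCoef w k ζ * testCoef φ ζ) : IsAdvection w b := by
  intro k φ
  rw [mem_sobolevVec_iff] at hw
  have hd : ∀ j, sobSq (s - 1)
      (moduli fun η => 2 * Real.pi * Complex.I * (η j : ℂ) * fourierCoef (w k) η) ≠ ⊤ := fun j =>
    ne_top_of_le_ne_top (ENNReal.mul_ne_top (by finiteness) (hw k)) (sobSq_deriv_le s j _)
  have h1 := hasSum_sum (s := Finset.univ) fun j _ =>
    h.hasSum_pairing (hw j) (hd j) (sobSq_testCoef_ne_top (-t) φ)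
  have h2 := h1.comp (tendsto_freqBall_prod (n := n))
  have hc : ∀ j, conv (fourierCoef (w j))
      (fun η => 2 * Real.pi * Complex.I * (η j : ℂ) * fourierCoef (w k) η) ∈ PolyGrowth n := fun j =>
    mem_polyGrowth_of_sobSq (ne_top_of_le_ne_top (h.absConv_ne_top (hw j) (hd j))
      (sobSq_mono (moduli_conv_le _ _)))
  rw [← Summable.tsum_finsetSum fun j _ => summable_mul_testCoef ⟨_, hc j⟩ φ] at h2
  rw [hb]
  simp only [advectionCoef, Finset.sum_mul, integral_smoothAdvection]
  exact h2

/-- Solenoidality holds frequency by frequency, hence survives truncation: `∑ ηⱼ ŵⱼ(ξ) = ∑ (ξ+η)ⱼ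
ŵⱼ(ξ)`. The derivative thus acts on the whole product and can be moved onto `φ`. -/
theorem isAdvection_of_divTensorCoef {s t : ℝ} (h : ProductBound n s s t)
    {w b : Fin n → Dist n} (hw : w ∈ SobolevVec n s) (hdiv : div w = 0)
    (hb : ∀ k φ, (b k).1 φ = ∑' ζ, divTensorCoef w w k ζ * testCoef φ ζ) : IsAdvection w b := by
  intro k φ
  rw [mem_sobolevVec_iff] at hw
  have h1 := hasSum_sum (s := Finset.univ) fun j _ =>
    h.hasSum_pairing (hw j) (hw k) (sobSq_testCoef_ne_top (-t) (-pderiv j φ))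
  have h2 := h1.comp (tendsto_freqBall_prod (n := n))
  have hc : ∀ j, conv (fourierCoef (w j)) (fourierCoef (w k)) ∈ PolyGrowth n := fun j =>
    mem_polyGrowth_of_sobSq (ne_top_of_le_ne_top (h.absConv_ne_top (hw j) (hw k))
      (sobSq_mono (moduli_conv_le _ _)))
  have hsum := Summable.tsum_finsetSum (s := Finset.univ)
    (f := fun j ζ => conv (fourierCoef (w j)) (fourierCoef (w k)) ζ * testCoef (-pderiv j φ) ζ)
    fun j _ => summable_mul_testCoef ⟨_, hc j⟩ (-pderiv j φ)
  rw [← hsum] at h2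
  have hψ : ∀ j ζ, testCoef (-pderiv j φ) ζ =
      2 * Real.pi * Complex.I * (ζ j : ℂ) * testCoef φ ζ := fun j ζ => by
    rw [← neg_one_smul ℂ, testCoef_smul, testCoef_pderiv]
    ring
  rw [hb]
  simp only [integral_smoothAdvection]
  simp only [hψ] at h2
  convert h2 using 2 with m
  -- The two summands differ by a multiple of `∑ ξⱼ ŵⱼ(ξ)`, with `ξ = p.1`, which vanishes.
  · refine Finset.sum_congr rfl fun p _ => ?_
    have h3 := sum_coord_mul_fourierCoef hdiv p.1
    rw [← sub_eq_zero, ← Finset.sum_sub_distrib]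
    have h4 : ∀ j, fourierCoef (w j) p.1 *
        (2 * Real.pi * Complex.I * (p.2 j : ℂ) * fourierCoef (w k) p.2) * testCoef φ (p.1 + p.2) -
        fourierCoef (w j) p.1 * fourierCoef (w k) p.2 * (2 * Real.pi * Complex.I *
          (((p.1 + p.2) j : ℤ) : ℂ) * testCoef φ (p.1 + p.2)) =
        -(2 * Real.pi * Complex.I * fourierCoef (w k) p.2 * testCoef φ (p.1 + p.2)) *
          ((p.1 j : ℂ) * fourierCoef (w j) p.1) := fun j => by
      simp only [Pi.add_apply]
      push_cast
      ring
    rw [Finset.sum_congr rfl fun j _ => h4 j, ← Finset.mul_sum, h3, mul_zero]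
  · refine tsum_congr fun ζ => ?_
    rw [divTensorCoef, Finset.sum_mul]
    exact Finset.sum_congr rfl fun j _ => by ring

theorem exists_advection_of_productBound {s t : ℝ} (h : ProductBound n s (s - 1) t) :
    ∃ C : ℝ, 0 ≤ C ∧ ∀ w ∈ SobolevVec n s, ∃ b ∈ SobolevVec n t,
      IsAdvection w b ∧ sobolevNorm t b ≤ C * sobolevNorm s w ^ 2 := by
  obtain ⟨C, hC, hb⟩ := exists_advectionCoef_bound h
  refine ⟨√C.toReal, Real.sqrt_nonneg _, fun w hw => ?_⟩
  have hv : vecSq s w ≠ ⊤ := ENNReal.sum_ne_top.2 fun k _ => mem_sobolevVec_iff.1 hw k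
  have h1 : ∀ k, sobSq t (moduli (advectionCoef w k)) ≠ ⊤ := fun k =>
    (ENNReal.sum_ne_top.1 (ne_top_of_le_ne_top (by finiteness) (hb w))) k (Finset.mem_univ k)
  let b : Fin n → Dist n := fun k => ofCoef n ⟨_, mem_polyGrowth_of_sobSq (h1 k)⟩
  have hcoef : ∀ k, fourierCoef (b k) = advectionCoef w k := fun k =>
    funext fun ζ => fourierCoef_ofCoef _ ζ
  have hbm : b ∈ SobolevVec n t := mem_sobolevVec_iff.2 fun k => by rw [hcoef]; exact h1 k
  refine ⟨b, hbm, isAdvection_of_advectionCoef h hw fun k φ => rfl, ?_⟩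
  rw [sq]
  refine sobolevNorm_le_of_vecSq hC hw hw hbm ?_
  unfold vecSq at hb ⊢
  simp only [hcoef]
  exact hb w

/-! ### The operator in divergence form: bilinearity, zero mean, boundedness -/

theorem sobSq_divTensorCoef_ne_top {s t : ℝ} (h : ProductBound n s s (t + 1))
    {u v : Fin n → Dist n} (hu : u ∈ SobolevVec n s) (hv : v ∈ SobolevVec n s) (k : Fin n) :
    sobSq t (moduli (divTensorCoef u v k)) ≠ ⊤ := by
  obtain ⟨C, hC, hb⟩ := exists_divTensorCoef_bound h
  have hu' : vecSq s u ≠ ⊤ := ENNReal.sum_ne_top.2 fun k _ => mem_sobolevVec_iff.1 hu k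
  have hv' : vecSq s v ≠ ⊤ := ENNReal.sum_ne_top.2 fun k _ => mem_sobolevVec_iff.1 hv k
  rw [add_sub_cancel_right] at hb
  exact (ENNReal.sum_ne_top.1 (ne_top_of_le_ne_top (by finiteness) (hb u v))) k (Finset.mem_univ k)

/-- The vector field `div (u ⊗ v)` for `u`, `v` of regularity `s`. -/
def divTensor {s t : ℝ} (h : ProductBound n s s (t + 1)) (u v : SobolevVec n s) :
    Fin n → Dist n :=
  fun k => ofCoef n ⟨_, mem_polyGrowth_of_sobSq (sobSq_divTensorCoef_ne_top h u.2 v.2 k)⟩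

theorem fourierCoef_divTensor {s t : ℝ} (h : ProductBound n s s (t + 1)) (u v : SobolevVec n s)
    (k : Fin n) : fourierCoef (divTensor h u v k) = divTensorCoef u.1 v.1 k :=
  funext fun ζ => fourierCoef_ofCoef _ ζ

theorem divTensor_mem {s t : ℝ} (h : ProductBound n s s (t + 1)) (u v : SobolevVec n s) :
    divTensor h u v ∈ SobolevDot n t := by
  refine ⟨mem_sobolevVec_iff.2 fun k => ?_, fun k => ?_⟩
  · rw [fourierCoef_divTensor]
    exact sobSq_divTensorCoef_ne_top h u.2 v.2 k
  -- The mean is the coefficient at `ζ = 0`, where every factor `ζⱼ` vanishes.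
  · have h1 := congrFun (fourierCoef_divTensor h u v k) 0
    simpa [fourierCoef, divTensorCoef] using h1

theorem exists_divTensor_bound {s t : ℝ} (h : ProductBound n s s (t + 1)) :
    ∃ C : ℝ, 0 ≤ C ∧ ∀ u v : SobolevVec n s,
      sobolevNorm t (divTensor h u v) ≤ C * (sobolevNorm s u.1 * sobolevNorm s v.1) := by
  obtain ⟨C, hC, hb⟩ := exists_divTensorCoef_bound h
  rw [add_sub_cancel_right] at hb
  refine ⟨√C.toReal, Real.sqrt_nonneg _, fun u v => ?_⟩
  refine sobolevNorm_le_of_vecSq hC u.2 v.2 (divTensor_mem h u v).1 ?_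
  refine le_trans (le_of_eq ?_) (hb u.1 v.1)
  exact Finset.sum_congr rfl fun k _ => by rw [fourierCoef_divTensor]

theorem conv_add_left {a a' b : Freq n → ℂ} {ζ : Freq n} (h : Summable fun ξ => a ξ * b (ζ - ξ))
    (h' : Summable fun ξ => a' ξ * b (ζ - ξ)) :
    conv (fun ξ => a ξ + a' ξ) b ζ = conv a b ζ + conv a' b ζ := by
  unfold conv
  rw [← h.tsum_add h']
  exact tsum_congr fun ξ => add_mul _ _ _

theorem conv_add_right {a b b' : Freq n → ℂ} {ζ : Freq n} (h : Summable fun ξ => a ξ * b (ζ - ξ))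
    (h' : Summable fun ξ => a ξ * b' (ζ - ξ)) :
    conv a (fun ξ => b ξ + b' ξ) ζ = conv a b ζ + conv a b' ζ := by
  unfold conv
  rw [← h.tsum_add h']
  exact tsum_congr fun ξ => mul_add _ _ _

theorem ProductBound.summable_conv {s₁ s₂ t : ℝ} (h : ProductBound n s₁ s₂ t) {f g : Dist n}
    (hf : sobSq s₁ (moduli (fourierCoef f)) ≠ ⊤) (hg : sobSq s₂ (moduli (fourierCoef g)) ≠ ⊤)
    (ζ : Freq n) : Summable fun ξ => fourierCoef f ξ * fourierCoef g (ζ - ξ) :=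
  TorusNS.summable_conv (ne_top_of_sobSq (h.absConv_ne_top hf hg) ζ)

theorem ofCoef_mk_add {a b c : Freq n → ℂ} (ha : a ∈ PolyGrowth n) (hb : b ∈ PolyGrowth n)
    (hc : c ∈ PolyGrowth n) (h : ∀ ζ, c ζ = a ζ + b ζ) :
    ofCoef n ⟨c, hc⟩ = ofCoef n ⟨a, ha⟩ + ofCoef n ⟨b, hb⟩ := by
  rw [← map_add]
  exact congrArg _ (Subtype.ext (funext h))

theorem ofCoef_mk_smul {a c : Freq n → ℂ} (r : ℂ) (ha : a ∈ PolyGrowth n) (hc : c ∈ PolyGrowth n)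
    (h : ∀ ζ, c ζ = r * a ζ) : ofCoef n ⟨c, hc⟩ = r • ofCoef n ⟨a, ha⟩ := by
  rw [← map_smul]
  exact congrArg _ (Subtype.ext (funext h))

theorem divTensor_add_left {s t : ℝ} (h : ProductBound n s s (t + 1)) (u u' v : SobolevVec n s) :
    divTensor h (u + u') v = divTensor h u v + divTensor h u' v := by
  refine funext fun k => ofCoef_mk_add _ _ _ fun ζ => ?_
  have hu := mem_sobolevVec_iff.1 u.2
  have hu' := mem_sobolevVec_iff.1 u'.2
  have hv := mem_sobolevVec_iff.1 v.2
  unfold divTensorCoef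
  rw [← Finset.sum_add_distrib]
  refine Finset.sum_congr rfl fun j _ => ?_
  rw [← mul_add]
  exact congrArg _ (conv_add_left (h.summable_conv (hu j) (hv k) ζ)
    (h.summable_conv (hu' j) (hv k) ζ))

theorem divTensor_add_right {s t : ℝ} (h : ProductBound n s s (t + 1)) (u v v' : SobolevVec n s) :
    divTensor h u (v + v') = divTensor h u v + divTensor h u v' := by
  refine funext fun k => ofCoef_mk_add _ _ _ fun ζ => ?_
  have hu := mem_sobolevVec_iff.1 u.2
  have hv := mem_sobolevVec_iff.1 v.2
  have hv' := mem_sobolevVec_iff.1 v'.2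
  unfold divTensorCoef
  rw [← Finset.sum_add_distrib]
  refine Finset.sum_congr rfl fun j _ => ?_
  rw [← mul_add]
  exact congrArg _ (conv_add_right (h.summable_conv (hu j) (hv k) ζ)
    (h.summable_conv (hu j) (hv' k) ζ))

theorem divTensor_smul_left {s t : ℝ} (h : ProductBound n s s (t + 1)) (c : ℂ)
    (u v : SobolevVec n s) : divTensor h (c • u) v = c • divTensor h u v := by
  refine funext fun k => ofCoef_mk_smul _ _ _ fun ζ => ?_
  unfold divTensorCoef conv
  rw [Finset.mul_sum]
  refine Finset.sum_congr rfl fun j _ => ?_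
  rw [mul_left_comm]
  refine congrArg _ (Eq.trans ?_ tsum_mul_left)
  exact tsum_congr fun ξ => mul_assoc c _ _

theorem divTensor_smul_right {s t : ℝ} (h : ProductBound n s s (t + 1)) (c : ℂ)
    (u v : SobolevVec n s) : divTensor h u (c • v) = c • divTensor h u v := by
  refine funext fun k => ofCoef_mk_smul _ _ _ fun ζ => ?_
  unfold divTensorCoef conv
  rw [Finset.mul_sum]
  refine Finset.sum_congr rfl fun j _ => ?_
  rw [mul_left_comm]
  refine congrArg _ (Eq.trans ?_ tsum_mul_left)
  exact tsum_congr fun ξ => mul_left_comm _ c _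

/-- `div (u ⊗ v)` as a bilinear map. -/
def divTensorBilin {s t : ℝ} (h : ProductBound n s s (t + 1)) :
    SobolevVec n s →ₗ[ℂ] SobolevVec n s →ₗ[ℂ] SobolevDot n t :=
  LinearMap.mk₂ ℂ (fun u v => ⟨divTensor h u v, divTensor_mem h u v⟩)
    (fun u u' v => Subtype.ext (divTensor_add_left h u u' v))
    (fun c u v => Subtype.ext (divTensor_smul_left h c u v))
    (fun u v v' => Subtype.ext (divTensor_add_right h u v v'))
    (fun c u v => Subtype.ext (divTensor_smul_right h c u v))

theorem isAdvection_divTensor {s t : ℝ} (h : ProductBound n s s (t + 1)) (w : SobolevVec n s)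
    (hdiv : div w.1 = 0) : IsAdvection w.1 (divTensor h w w) :=
  isAdvection_of_divTensorCoef h w.2 hdiv fun _ _ => rfl

/-- The inclusion of the solenoidal fields of zero mean. -/
def solenoidalInclusion (n : ℕ) (s : ℝ) : SobolevDotSigma n s →ₗ[ℂ] SobolevVec n s :=
  Submodule.inclusion fun _ hw => hw.1.1

/-- The operator `B w = (w·∇)w = div (w ⊗ w)` on solenoidal fields. -/
def advectionMap {s t : ℝ} (h : ProductBound n s s (t + 1)) :
    QuadraticMap ℂ (SobolevDotSigma n s) (SobolevDot n t) :=
  LinearMap.BilinMap.toQuadraticMap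
    ((divTensorBilin h).compl₁₂ (solenoidalInclusion n s) (solenoidalInclusion n s))

/-! ### Continuity and boundedness on solenoidal fields -/

/-- The increment of the quadratic map, written so that each term contains the displacement `u` once
as a factor. -/
theorem divTensor_sub_divTensor {s t : ℝ} (h : ProductBound n s s (t + 1)) (u v : SobolevVec n s) :
    divTensor h (u + v) (u + v) - divTensor h v v =
      divTensor h u (u + v) + divTensor h v u := by
  rw [divTensor_add_left, divTensor_add_right h v, ← add_assoc, add_sub_cancel_right]

theorem sobolevNorm_divTensor_sub_sq_le {s t : ℝ} (h : ProductBound n s s (t + 1)) {A : ℝ}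
    (hb : ∀ u v : SobolevVec n s,
      sobolevNorm t (divTensor h u v) ≤ A * (sobolevNorm s u.1 * sobolevNorm s v.1))
    (u v : SobolevVec n s) :
    sobolevNorm t (divTensor h (u + v) (u + v) - divTensor h v v) ^ 2 ≤
      2 * A ^ 2 * (2 * sobolevNorm s u.1 ^ 2 + 3 * sobolevNorm s v.1 ^ 2) *
        sobolevNorm s u.1 ^ 2 := by
  have h1 := pow_le_pow_left₀ (sobolevNorm_nonneg _ _) (hb u (u + v)) 2
  have h2 := pow_le_pow_left₀ (sobolevNorm_nonneg _ _) (hb v u) 2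
  have h3 : sobolevNorm s (u + v).1 ^ 2 ≤ _ := sobolevNorm_add_sq_le u.2 v.2
  have h4 := sobolevNorm_add_sq_le (divTensor_mem h u (u + v)).1 (divTensor_mem h v u).1
  rw [divTensor_sub_divTensor]
  have h5 := mul_le_mul_of_nonneg_left h3 (mul_nonneg (sq_nonneg A) (sq_nonneg (sobolevNorm s u.1)))
  refine h4.trans ?_
  simp only [mul_pow] at h1 h2
  linarith

theorem exists_sqrt_bound (Q : ℝ) (hQ : 0 < Q) {ε : ℝ} (hε : 0 < ε) :
    ∃ δ, 0 < δ ∧ δ ≤ 1 ∧ ∀ x y : ℝ, 0 ≤ x → x < δ → y ^ 2 ≤ Q * x ^ 2 → y < ε := by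
  refine ⟨min 1 (ε / √Q), by positivity, min_le_left _ _, fun x y hx hxδ hy => ?_⟩
  have h1 := hxδ.trans_le (min_le_right _ _)
  rw [lt_div_iff₀ (by positivity)] at h1
  refine lt_of_pow_lt_pow_left₀ 2 hε.le (hy.trans_lt ?_)
  calc Q * x ^ 2 = (x * √Q) ^ 2 := by rw [mul_pow, Real.sq_sqrt hQ.le]; ring
    _ < ε ^ 2 := by gcongr

theorem sobolevContinuous_advectionMap {s t : ℝ} (h : ProductBound n s s (t + 1)) :
    SobolevContinuous s t (advectionMap h) := by
  obtain ⟨A, -, hb⟩ := exists_divTensor_bound h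
  intro w ε hε
  -- The coefficient of the increment bound with the displacement norm replaced by its bound `1`;
  -- the extra `1` keeps it positive.
  obtain ⟨δ, hδ, hδ1, hlt⟩ := exists_sqrt_bound
    (2 * A ^ 2 * (2 + 3 * sobolevNorm s w.1 ^ 2) + 1) (by positivity) hε
  refine ⟨δ, hδ, fun w' hw' => hlt _ _ (sobolevNorm_nonneg _ _) hw' ?_⟩
  have h1 := sobolevNorm_divTensor_sub_sq_le h hb (solenoidalInclusion n s (w' - w))
    (solenoidalInclusion n s w)
  have e : w' - w + w = w' := Subtype.ext (sub_add_cancel w'.1 w.1)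
  rw [← map_add, e] at h1
  refine LE.le.trans (b := 2 * A ^ 2 * (2 * sobolevNorm s (w'.1 - w.1) ^ 2 +
    3 * sobolevNorm s w.1 ^ 2) * sobolevNorm s (w'.1 - w.1) ^ 2) h1 ?_
  have h2 : sobolevNorm s (w'.1 - w.1) ^ 2 ≤ 1 :=
    pow_le_one₀ (sobolevNorm_nonneg _ _) (hw'.le.trans hδ1)
  gcongr ?_ * _
  have h3 : 2 * A ^ 2 * (2 * sobolevNorm s (w'.1 - w.1) ^ 2 + 3 * sobolevNorm s w.1 ^ 2) ≤
      2 * A ^ 2 * (2 * 1 + 3 * sobolevNorm s w.1 ^ 2) := by gcongr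
  linarith

theorem exists_solenoidal_bound {s t : ℝ} (h : ProductBound n s s (t + 1)) :
    ∃ C : ℝ, 0 ≤ C ∧
      (∀ w : SobolevDotSigma n s,
        sobolevNorm t (advectionMap h w).1 ≤ C * sobolevNorm s w.1 ^ 2) ∧
      ∀ w ∈ SobolevVec n s, div w = 0 → ∃ b ∈ SobolevVec n t,
        IsAdvection w b ∧ sobolevNorm t b ≤ C * sobolevNorm s w ^ 2 := by
  obtain ⟨C, hC, hb⟩ := exists_divTensor_bound h
  refine ⟨C, hC, fun w => ?_, fun w hw hdiv => ?_⟩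
  · rw [sq]
    exact hb (solenoidalInclusion n s w) (solenoidalInclusion n s w)
  · refine ⟨_, (divTensor_mem h ⟨w, hw⟩ ⟨w, hw⟩).1, isAdvection_divTensor h ⟨w, hw⟩ hdiv, ?_⟩
    rw [sq]
    exact hb ⟨w, hw⟩ ⟨w, hw⟩

theorem isAdvection_advectionMap {s t : ℝ} (h : ProductBound n s s (t + 1))
    (w : SobolevDotSigma n s) : IsAdvection w.1 (advectionMap h w).1 :=
  isAdvection_divTensor h (solenoidalInclusion n s w) w.2.2

end TorusNS

end

/-! ### Assembly of the two regimes -/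

theorem theorem3 (n : ℕ) (hn : 2 ≤ n) (s : ℝ) :
    (0 < s → s < (n : ℝ) / 2 →
      ∃ B : QuadraticMap ℂ (TorusNS.SobolevDotSigma n s)
          (TorusNS.SobolevDot n (2 * s - 1 - (n : ℝ) / 2)),
        (∀ w : TorusNS.SobolevDotSigma n s, TorusNS.IsAdvection w.1 (B w).1) ∧
        TorusNS.SobolevContinuous s (2 * s - 1 - (n : ℝ) / 2) B ∧
        ∃ C : ℝ, 0 < C ∧
          (∀ w : TorusNS.SobolevDotSigma n s,
            TorusNS.sobolevNorm (2 * s - 1 - (n : ℝ) / 2) (B w : Fin n → TorusNS.Dist n) ≤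
              C * TorusNS.sobolevNorm s (w : Fin n → TorusNS.Dist n) ^ 2) ∧
          (∀ w ∈ TorusNS.SobolevVec n s, (TorusNS.div w = 0 ∨ 1 / 2 < s) →
            ∃ b ∈ TorusNS.SobolevVec n (2 * s - 1 - (n : ℝ) / 2),
              TorusNS.IsAdvection w b ∧
              TorusNS.sobolevNorm (2 * s - 1 - (n : ℝ) / 2) b ≤
                C * TorusNS.sobolevNorm s w ^ 2)) ∧
    ((n : ℝ) / 2 < s →
      ∃ B : QuadraticMap ℂ (TorusNS.SobolevDotSigma n s) (TorusNS.SobolevDot n (s - 1)),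
        (∀ w : TorusNS.SobolevDotSigma n s, TorusNS.IsAdvection w.1 (B w).1) ∧
        TorusNS.SobolevContinuous s (s - 1) B ∧
        ∃ C : ℝ, 0 < C ∧
          (∀ w : TorusNS.SobolevDotSigma n s,
            TorusNS.sobolevNorm (s - 1) (B w : Fin n → TorusNS.Dist n) ≤
              C * TorusNS.sobolevNorm s (w : Fin n → TorusNS.Dist n) ^ 2) ∧
          (∀ w ∈ TorusNS.SobolevVec n s,
            ∃ b ∈ TorusNS.SobolevVec n (s - 1),
              TorusNS.IsAdvection w b ∧
              TorusNS.sobolevNorm (s - 1) b ≤ C * TorusNS.sobolevNorm s w ^ 2)) := by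
  have hn' : (2 : ℝ) ≤ n := by exact_mod_cast hn
  constructor
  · intro hs hsn
    have h : TorusNS.ProductBound n s s (2 * s - 1 - (n : ℝ) / 2 + 1) := by
      have := TorusNS.productBound_subcritical hsn hsn (by linarith)
      rwa [show s + s - (n : ℝ) / 2 = 2 * s - 1 - (n : ℝ) / 2 + 1 by ring] at this
    obtain ⟨C, hC, h1, h2⟩ := TorusNS.exists_solenoidal_bound h
    -- For `s ≤ 1/2` the claim is vacuous and `D = 0` serves, so one constant can be fixed before
    -- the cases on `w` are separated.
    have h3 : ∃ D : ℝ, 0 ≤ D ∧ (1 / 2 < s → ∀ w ∈ TorusNS.SobolevVec n s,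
        ∃ b ∈ TorusNS.SobolevVec n (2 * s - 1 - (n : ℝ) / 2), TorusNS.IsAdvection w b ∧
          TorusNS.sobolevNorm (2 * s - 1 - (n : ℝ) / 2) b ≤ D * TorusNS.sobolevNorm s w ^ 2) := by
      by_cases hs' : 1 / 2 < s
      · have h4 := TorusNS.productBound_subcritical (s₂ := s - 1) hsn (by linarith) (by linarith)
        rw [show s + (s - 1) - (n : ℝ) / 2 = 2 * s - 1 - (n : ℝ) / 2 by ring] at h4
        obtain ⟨D, hD, h5⟩ := TorusNS.exists_advection_of_productBound h4
        exact ⟨D, hD, fun _ => h5⟩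
      · exact ⟨0, le_rfl, fun h => absurd h hs'⟩
    obtain ⟨D, hD, h3⟩ := h3
    -- `C + D + 1` dominates the constants of both routes and is strictly positive.
    refine ⟨TorusNS.advectionMap h, TorusNS.isAdvection_advectionMap h,
      TorusNS.sobolevContinuous_advectionMap h, C + D + 1, by positivity, fun w => ?_,
      fun w hw hor => ?_⟩
    · refine (h1 w).trans ?_
      gcongr
      linarith
    · rcases hor with hdiv | hs'
      · obtain ⟨b, hb, hadv, hle⟩ := h2 w hw hdiv
        refine ⟨b, hb, hadv, hle.trans ?_⟩
        gcongr
        linarith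
      · obtain ⟨b, hb, hadv, hle⟩ := h3 hs' w hw
        refine ⟨b, hb, hadv, hle.trans ?_⟩
        gcongr
        linarith
  · intro hsn
    have h : TorusNS.ProductBound n s s (s - 1 + 1) := by
      rw [sub_add_cancel]
      exact TorusNS.productBound_supercritical hsn (by linarith) le_rfl
    obtain ⟨C, hC, h1, -⟩ := TorusNS.exists_solenoidal_bound h
    -- Here `n ≥ 2` enters: `s > n/2 ≥ 1` gives the nonnegativity of `s - 1` required by the
    -- supercritical law.
    obtain ⟨D, hD, h3⟩ := TorusNS.exists_advection_of_productBound
      (TorusNS.productBound_supercritical hsn (s₂ := s - 1) (by linarith) (by linarith))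
    refine ⟨TorusNS.advectionMap h, TorusNS.isAdvection_advectionMap h,
      TorusNS.sobolevContinuous_advectionMap h, C + D + 1, by positivity, fun w => ?_,
      fun w hw => ?_⟩
    · refine (h1 w).trans ?_
      gcongr
      linarith
    · obtain ⟨b, hb, hadv, hle⟩ := h3 w hw
      refine ⟨b, hb, hadv, hle.trans ?_⟩
      gcongr
      linarith
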